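/- Let $H$ be a complex Hilbert space and let $\mathcal A\subseteq \mathbb B(H)$ be a reflexive operator algebra, i.e. a unital subalgebra with $\mathcal A=\{x\in\mathbb B(H): p^{\perp}xp=0 \text{ for all } p\in\mathrm{Lat}\,\mathcal A\}$, where $p^\perp=1-p$ and $\mathrm{Lat}\,\mathcal A$ is the set of all (orthogonal) projections $p\in\mathbb B(H)$ with $p^{\perp}ap=0$ for all $a\in\mathcal A$. Write $\Delta(\mathcal A)=\mathcal A\cap\mathcal A^*$ and let $\Delta(\mathcal A)'$ be its commutant in $\mathbb B(H)$, so that $\mathrm{Lat}\,\mathcal A\subseteq\Delta(\mathcal A)'$. Let $L$ be a complex Hilbert space and let $Y\subseteq\mathbb B(H,L)$ be a dual operator space, i.e. a w*-closed (equivalently, $\sigma$-weakly closed) linear subspace. The following are equivalent. (i) $Y$ is a concrete strongly projectively right w*-rigged module over $\mathcal A$: there is a w*-closed linear subspace $M\subseteq\mathbb B(H,L)$ with $MM^*M\subseteq M$ such that $M^*M\subseteq\mathcal A$, the identity of the w*-closed linear span $\overline{[M^*M]}^{w^*}$ is the identity of $\mathcal A$, and $Y=\overline{[M\mathcal A]}^{w^*}$,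 the w*-closed linear span of $\{ma: m\in M,\ a\in\mathcal A\}$. (ii) There are a closed subspace $K$ of $L$, a reflexive operator algebra $\mathcal B\subseteq\mathbb B(K)$ and a $*$-isomorphism $\theta:\Delta(\mathcal A)'\to\Delta(\mathcal B)'$ such that $\theta(\mathrm{Lat}\,\mathcal A)=\mathrm{Lat}\,\mathcal B$ and $$Y=\{y\in\mathbb B(H,K): \theta(p)^{\perp}\,y\,p=0 \text{ for all } p\in\mathrm{Lat}\,\mathcal A\},$$ where $\mathbb B(H,K)$ is regarded as the subspace of $\mathbb B(H,L)$ of the operators whose range lies in $K$. -/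

import Mathlib

open ContinuousLinearMap

namespace RiggedModules

section Topology

variable {H K : Type*} [NormedAddCommGroup H] [InnerProductSpace ℂ H]
  [NormedAddCommGroup K] [InnerProductSpace ℂ K]

/-- The functional `x ↦ ∑ₙ ⟪ηₙ, x ξₙ⟫` on `B(H, K)` given by two square-summable sequences. These
are exactly the functionals coming from the predual of `B(H, K)`, the trace class operators. -/
noncomputable def normalFunctional (ξ : lp (fun _ : ℕ => H) 2) (η : lp (fun _ : ℕ => K) 2)
    (x : H →L[ℂ] K) : ℂ :=
  ∑' n, inner ℂ (η n) (x (ξ n))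

/-- The series in the definition of `normalFunctional` always converges. -/
theorem summable_normalFunctional (ξ : lp (fun _ : ℕ => H) 2) (η : lp (fun _ : ℕ => K) 2)
    (x : H →L[ℂ] K) : Summable fun n => inner ℂ (η n) (x (ξ n)) := by
  have hξ : Summable fun n => ‖ξ n‖ ^ 2 := by
    simpa using (lp.memℓp ξ).summable (by norm_num)
  have hη : Summable fun n => ‖η n‖ ^ 2 := by
    simpa using (lp.memℓp η).summable (by norm_num)
  refine Summable.of_norm_bounded ((hη.add hξ).mul_left ‖x‖) fun n => ?_
  have h1 : ‖inner ℂ (η n) (x (ξ n))‖ ≤ ‖η n‖ * ‖x (ξ n)‖ := norm_inner_le_norm _ _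
  have h2 : ‖η n‖ * ‖x (ξ n)‖ ≤ ‖η n‖ * (‖x‖ * ‖ξ n‖) :=
    mul_le_mul_of_nonneg_left (x.le_opNorm _) (norm_nonneg _)
  have h3 : ‖η n‖ * ‖ξ n‖ ≤ ‖η n‖ ^ 2 + ‖ξ n‖ ^ 2 := by
    nlinarith [sq_nonneg (‖η n‖ - ‖ξ n‖), sq_nonneg ‖η n‖, sq_nonneg ‖ξ n‖]
  have h4 := mul_le_mul_of_nonneg_left h3 (norm_nonneg x)
  linarith

/-- The w*-topology (σ-weak, or ultraweak, topology) of `B(H, K)`. -/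
@[reducible]
noncomputable def wStarTopology (H K : Type*) [NormedAddCommGroup H] [InnerProductSpace ℂ H]
    [NormedAddCommGroup K] [InnerProductSpace ℂ K] : TopologicalSpace (H →L[ℂ] K) :=
  ⨅ (ξ : lp (fun _ : ℕ => H) 2) (η : lp (fun _ : ℕ => K) 2),
    TopologicalSpace.induced (normalFunctional ξ η) inferInstance

/-- `S` is w*-closed in `B(H, K)`. -/
def IsWStarClosed (S : Set (H →L[ℂ] K)) : Prop :=
  @IsClosed _ (wStarTopology H K) S

/-- The w*-closure of the linear span of `S` in `B(H, K)`. -/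
def wStarSpan (S : Set (H →L[ℂ] K)) : Set (H →L[ℂ] K) :=
  @closure _ (wStarTopology H K) (Submodule.span ℂ S : Set (H →L[ℂ] K))

/-- The set of products `y x` with `y ∈ Y ⊆ B(K, L)` and `x ∈ X ⊆ B(H, K)`. -/
def prodSet {L : Type*} [NormedAddCommGroup L] [InnerProductSpace ℂ L]
    (Y : Set (K →L[ℂ] L)) (X : Set (H →L[ℂ] K)) : Set (H →L[ℂ] L) :=
  {z | ∃ y ∈ Y, ∃ x ∈ X, z = y ∘L x}

end Topology

section Reflexive

variable {H : Type*} [NormedAddCommGroup H] [InnerProductSpace ℂ H] [CompleteSpace H]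

/-- `Lat 𝒜`: the projections `p` with `p^⊥ a p = 0` for all `a ∈ 𝒜`. -/
def latOf (A : Set (H →L[ℂ] H)) : Set (H →L[ℂ] H) :=
  {p | IsStarProjection p ∧ ∀ a ∈ A, (1 - p) * a * p = 0}

/-- `Alg ℒ`: the operators `x` with `p^⊥ x p = 0` for all `p ∈ ℒ`. -/
def algOf (L : Set (H →L[ℂ] H)) : Set (H →L[ℂ] H) :=
  {x | ∀ p ∈ L, (1 - p) * x * p = 0}

/-- The algebra `𝒜` is reflexive: `𝒜 = Alg (Lat 𝒜)`. -/
def IsReflexiveAlgebra (A : Subalgebra ℂ (H →L[ℂ] H)) : Prop :=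
  (A : Set (H →L[ℂ] H)) = algOf (latOf (A : Set (H →L[ℂ] H)))

/-- The diagonal `Δ(𝒜) = 𝒜 ∩ 𝒜*`. -/
def diagonal (A : Subalgebra ℂ (H →L[ℂ] H)) : Set (H →L[ℂ] H) :=
  {a | a ∈ A ∧ star a ∈ A}

/-- The commutant `Δ(𝒜)'` of the diagonal, as a *-algebra of operators on `H`. -/
noncomputable def diagCommutant (A : Subalgebra ℂ (H →L[ℂ] H)) : StarSubalgebra ℂ (H →L[ℂ] H) :=
  StarSubalgebra.centralizer ℂ (diagonal A)

theorem mem_diagCommutant_iff (A : Subalgebra ℂ (H →L[ℂ] H)) (x : H →L[ℂ] H) :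
    x ∈ diagCommutant A ↔ ∀ a ∈ diagonal A, a * x = x * a := by
  rw [diagCommutant, StarSubalgebra.mem_centralizer_iff]
  exact ⟨fun h a ha => (h a ha).1,
    fun h a ha => ⟨h a ha, h _ ⟨ha.2, by simpa using ha.1⟩⟩⟩

/-- `Lat 𝒜 ⊆ Δ(𝒜)'`. -/
theorem latOf_subset_diagCommutant (A : Subalgebra ℂ (H →L[ℂ] H)) :
    latOf (A : Set (H →L[ℂ] H)) ⊆ diagCommutant A := by
  intro p hp
  rw [SetLike.mem_coe, mem_diagCommutant_iff]
  intro a ha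
  have h1 : a * p = p * a * p := by
    have := hp.2 a ha.1
    rwa [sub_mul, sub_mul, one_mul, sub_eq_zero] at this
  have h2 : star a * p = p * star a * p := by
    have := hp.2 (star a) ha.2
    rwa [sub_mul, sub_mul, one_mul, sub_eq_zero] at this
  have h3 : p * a = p * a * p := by
    have := congrArg star h2
    simpa [hp.1.isSelfAdjoint.star_eq, mul_assoc] using this
  rw [h1, ← h3]

end Reflexive

section Modules

variable {H K : Type*} [NormedAddCommGroup H] [InnerProductSpace ℂ H] [CompleteSpace H]
  [NormedAddCommGroup K] [InnerProductSpace ℂ K] [CompleteSpace K]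

/-- `M ⊆ B(H, K)` is a w*-closed ternary ring of operators: a w*-closed linear subspace with
`M M* M ⊆ M`. -/
structure IsWStarClosedTRO (M : Submodule ℂ (H →L[ℂ] K)) : Prop where
  isWStarClosed : IsWStarClosed (M : Set (H →L[ℂ] K))
  ternary_mem : ∀ m₁ ∈ M, ∀ m₂ ∈ M, ∀ m₃ ∈ M, m₁ ∘L adjoint m₂ ∘L m₃ ∈ M

/-- The set of adjoints `M* = {m* : m ∈ M} ⊆ B(K, H)`. -/
def adjointSet (M : Set (H →L[ℂ] K)) : Set (K →L[ℂ] H) :=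
  {x | ∃ m ∈ M, x = adjoint m}

/-- `Y ⊆ B(H, K)` is a concrete strongly projectively right w*-rigged module over the unital
algebra `𝒜 ⊆ B(H)`: there is a w*-closed TRO `M ⊆ B(H, K)` such that `M* M ⊆ 𝒜`, the identity of
the w*-closed algebra generated by `M* M` is the identity of `𝒜`, and `Y` is the w*-closed span of
`M 𝒜`. As `1` acts as an identity on all operators of `H`, it is the identity of the former
algebra precisely when it belongs to it. -/
def IsConcreteStronglyProjectivelyRigged (A : Subalgebra ℂ (H →L[ℂ] H))
    (Y : Submodule ℂ (H →L[ℂ] K)) : Prop :=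
  ∃ M : Submodule ℂ (H →L[ℂ] K), IsWStarClosedTRO M ∧
    prodSet (adjointSet (M : Set (H →L[ℂ] K))) (M : Set (H →L[ℂ] K)) ⊆ A ∧
    (1 : H →L[ℂ] H) ∈
      wStarSpan (prodSet (adjointSet (M : Set (H →L[ℂ] K))) (M : Set (H →L[ℂ] K))) ∧
    (Y : Set (H →L[ℂ] K)) = wStarSpan (prodSet (M : Set (H →L[ℂ] K)) (A : Set (H →L[ℂ] H)))

/-- The space `{y ∈ B(H, K) : θ(p)^⊥ y p = 0 for all p ∈ Lat 𝒜}` of a map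
`θ : Δ(𝒜)' → Δ(ℬ)'`. -/
def opSpace {A : Subalgebra ℂ (H →L[ℂ] H)} {B : Subalgebra ℂ (K →L[ℂ] K)}
    (θ : diagCommutant A → diagCommutant B) : Set (H →L[ℂ] K) :=
  {y | ∀ p : diagCommutant A, (p : H →L[ℂ] H) ∈ latOf (A : Set (H →L[ℂ] H)) →
    (1 - (θ p : K →L[ℂ] K)) ∘L y ∘L (p : H →L[ℂ] H) = 0}

end Modules

end RiggedModules

/-!
Both conditions are mediated by a ternary ring of operators `M ⊆ B(H, K)` for which neither `M` nor
`M*` has a common kernel, and by the relation `θ(x) m = m x` for `x ∈ Δ(𝒜)'` and `m ∈ M`.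

From `M` to `θ`: let `K` be the closed span of the ranges of `M`. As `M* M ⊆ Δ(𝒜)`, an operator
`x ∈ Δ(𝒜)'` commutes with `M* M`, and `m ξ ↦ m x ξ` defines an operator `θ(x)` on `K`
(`exists_transport`). Let `ℬ` be the algebra of all operators leaving `θ(Lat 𝒜)` invariant. Then
`M 𝒜 M* ⊆ ℬ` and `M* ℬ M ⊆ 𝒜`, and as `M` and `M*` can be cancelled, this identifies `Δ(ℬ)'` with
`θ(Δ(𝒜)')` and `Lat ℬ` with `θ(Lat 𝒜)` (`exists_starAlgEquiv_of_separating`).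

From `θ` to `M`: let `M` be the space of all intertwiners of `θ`. The point is that they separate
the points of `H` (`eq_zero_of_forall_intertwiner`); applied to the inverse of `θ`, this says that
the adjoints separate the points of `K`. If the projection `e` onto the common kernel of the
intertwiners were not zero, one would take a vector state `⟪k, θ(·) k⟫` with `θ(e) k = k`, pull back
its support projection to `e' ≤ e`, and compare the state with `⟪η, · η⟫` for a longer vector `η` in
the range of `e'`. Among the `x` with `0 ≤ x ≤ e'` and `⟪η, x η⟫ ≤ ⟪k, θ(x) k⟫` there is a maximal
one, because chains have strong limits; its complement `y` is not zero and the opposite inequality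
holds below `y`. With `h = √y` one gets `‖θ(x) θ(h) k‖ ≤ ‖x h η‖` for all `x`, so that
`x h η ↦ θ(x) θ(h) k` extends to an intertwiner that does not vanish on the range of `e`. The
argument does not need the automatic normality of `θ`.

In both cases the module is recovered as follows: if `θ(p)^⊥ y p = 0` for all `p ∈ Lat 𝒜`, then
`M* y ⊆ 𝒜`, so `M M* y ⊆ M 𝒜`, and `y` is in the w*-closed span of `M M* y` by the argument of the
double commutant theorem (`mem_wStarSpan_of_ternary`, `wStarSpan_prodSet_eq_opSpace`).
-/

namespace RiggedModules

/-! ### The w*-topology and the double commutant argument -/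

section WStar

variable {G H K L : Type*} [NormedAddCommGroup G] [InnerProductSpace ℂ G]
  [NormedAddCommGroup H] [InnerProductSpace ℂ H] [NormedAddCommGroup K] [InnerProductSpace ℂ K]
  [NormedAddCommGroup L] [InnerProductSpace ℂ L]

theorem wStarTopology_eq_induced :
    wStarTopology H K = TopologicalSpace.induced
      (fun (x : H →L[ℂ] K) (i : lp (fun _ : ℕ => H) 2 × lp (fun _ : ℕ => K) 2) =>
        normalFunctional i.1 i.2 x) Pi.topologicalSpace := by
  simp only [Pi.topologicalSpace, induced_iInf, induced_compose, wStarTopology, iInf_prod]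
  rfl

theorem mem_wStar_closure_iff {S : Set (H →L[ℂ] K)} {x : H →L[ℂ] K} :
    x ∈ @closure _ (wStarTopology H K) S ↔
      ∀ (I : Finset (lp (fun _ : ℕ => H) 2 × lp (fun _ : ℕ => K) 2))
        (u : lp (fun _ : ℕ => H) 2 × lp (fun _ : ℕ => K) 2 → Set ℂ),
        (∀ i ∈ I, IsOpen (u i) ∧ normalFunctional i.1 i.2 x ∈ u i) →
          ∃ s ∈ S, ∀ i ∈ I, normalFunctional i.1 i.2 s ∈ u i := by
  rw [wStarTopology_eq_induced]
  rw [closure_induced, mem_closure_iff]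
  constructor
  · intro h I u hu
    obtain ⟨z, hz, s, hs, rfl⟩ := h ((I : Set _).pi u)
      (isOpen_set_pi I.finite_toSet fun i hi => (hu i hi).1) (fun i hi => (hu i hi).2)
    exact ⟨s, hs, fun i hi => hz i hi⟩
  · intro h o ho hx
    obtain ⟨I, u, hu, huo⟩ := isOpen_pi_iff.1 ho _ hx
    obtain ⟨s, hs, hsu⟩ := h I u hu
    exact ⟨_, huo fun i hi => hsu i hi, s, hs, rfl⟩

theorem continuous_normalFunctional (ξ : lp (fun _ : ℕ => H) 2) (η : lp (fun _ : ℕ => K) 2) :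
    @Continuous _ _ (wStarTopology H K) _ (normalFunctional ξ η) := by
  exact continuous_iff_le_induced.2 (iInf₂_le (f := fun ξ η =>
    TopologicalSpace.induced (normalFunctional (H := H) (K := K) ξ η) inferInstance) ξ η)

theorem normalFunctional_single (ξ : H) (η : K) (x : H →L[ℂ] K) :
    normalFunctional (lp.single 2 0 ξ) (lp.single 2 0 η) x = inner ℂ η (x ξ) := by
  rw [normalFunctional, tsum_eq_single 0]
  · simp
  · intro n hn
    simp [lp.single_apply, hn]

theorem continuous_wStar_inner (ξ : H) (η : K) :
    @Continuous _ _ (wStarTopology H K) _ (fun x : H →L[ℂ] K => inner ℂ η (x ξ)) := by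
  have h := continuous_normalFunctional (lp.single 2 0 ξ) (lp.single 2 0 η)
  rwa [show normalFunctional (lp.single 2 0 ξ) (lp.single 2 0 η) =
    fun x : H →L[ℂ] K => inner ℂ η (x ξ) from funext (normalFunctional_single ξ η)] at h

theorem isWStarClosed_setOf_inner {ι : Sort*} (η η' : ι → K) (ξ ξ' : ι → H) :
    IsWStarClosed {x : H →L[ℂ] K | ∀ i, inner ℂ (η i) (x (ξ i)) = inner ℂ (η' i) (x (ξ' i))} := by
  rw [IsWStarClosed, Set.ofPred_forall]
  let := wStarTopology H K
  exact isClosed_iInter fun i =>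
    isClosed_eq (continuous_wStar_inner _ _) (continuous_wStar_inner _ _)

theorem IsWStarClosed.inter {S T : Set (H →L[ℂ] K)} (hS : IsWStarClosed S)
    (hT : IsWStarClosed T) : IsWStarClosed (S ∩ T) := by
  let := wStarTopology H K
  exact IsClosed.inter (X := H →L[ℂ] K) hS hT

theorem wStarSpan_subset {S : Set (H →L[ℂ] K)} {Y : Submodule ℂ (H →L[ℂ] K)}
    (hY : IsWStarClosed (Y : Set (H →L[ℂ] K))) (h : S ⊆ Y) : wStarSpan S ⊆ Y :=
  @closure_minimal _ (wStarTopology H K) _ _ (Submodule.span_le.2 h : Submodule.span ℂ S ≤ Y) hY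

theorem wStarSpan_subset_wStarSpan {S T : Set (H →L[ℂ] K)}
    (h : S ⊆ (Submodule.span ℂ T : Set (H →L[ℂ] K))) : wStarSpan S ⊆ wStarSpan T :=
  @closure_mono _ (wStarTopology H K) _ _ (Submodule.span_le.2 h : Submodule.span ℂ S ≤ _)

theorem wStarSpan_mono {S T : Set (H →L[ℂ] K)} (h : S ⊆ T) : wStarSpan S ⊆ wStarSpan T :=
  wStarSpan_subset_wStarSpan (h.trans Submodule.subset_span)

end WStar

section Density

/-- The square-summable family over `I × ℕ` made of the sequences `x (ξ i)`, `i ∈ I`. -/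
noncomputable def prodFamily {I E : Type*} [NormedAddCommGroup E] [Finite I]
    (ξ : I → lp (fun _ : ℕ => E) 2) :
    lp (fun _ : I × ℕ => E) 2 :=
  ⟨fun i => ξ i.1 i.2, by
    refine memℓp_gen ?_
    rw [summable_prod_of_nonneg fun i => by positivity]
    exact ⟨fun i => (lp.memℓp (ξ i)).summable (by norm_num), Summable.of_finite⟩⟩

@[simp]
theorem prodFamily_apply {I E : Type*} [NormedAddCommGroup E] [Finite I]
    (ξ : I → lp (fun _ : ℕ => E) 2) (i : I × ℕ) :
    prodFamily ξ i = ξ i.1 i.2 := rfl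

variable {ι : Type*} {H K : Type*} [NormedAddCommGroup H] [InnerProductSpace ℂ H]
  [NormedAddCommGroup K] [InnerProductSpace ℂ K]

/-- The ampliation `ξ ↦ (x ξᵢ)ᵢ` of `x ∈ B(H, K)` to square-summable families. -/
noncomputable def ampliation (ι : Type*) (x : H →L[ℂ] K) :
    lp (fun _ : ι => H) 2 →ₗ[ℂ] lp (fun _ : ι => K) 2 where
  toFun ξ := ⟨fun i => x (ξ i), by
    have hξ : Summable fun n => ‖ξ n‖ ^ 2 := by
      simpa using (lp.memℓp ξ).summable (by norm_num)
    refine memℓp_gen ?_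
    refine Summable.of_nonneg_of_le (fun i => by positivity) (fun i => ?_)
      (hξ.mul_left (‖x‖ ^ 2))
    have := x.le_opNorm (ξ i)
    simpa [mul_pow] using pow_le_pow_left₀ (norm_nonneg _) this 2⟩
  map_add' ξ ξ' := by ext i; exact map_add x (ξ i) (ξ' i)
  map_smul' c ξ := by ext i; exact map_smul x c (ξ i)

@[simp]
theorem ampliation_apply (x : H →L[ℂ] K) (ξ : lp (fun _ : ι => H) 2) (i : ι) :
    ampliation ι x ξ i = x (ξ i) := rfl

theorem inner_ampliation [CompleteSpace H] [CompleteSpace K] (x : H →L[ℂ] K)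
    (ξ : lp (fun _ : ι => H) 2) (η : lp (fun _ : ι => K) 2) :
    inner ℂ η (ampliation ι x ξ) = inner ℂ (ampliation ι (adjoint x) η) ξ := by
  simp [lp.inner_eq_tsum, adjoint_inner_left]

variable {L : Type*} [NormedAddCommGroup L] [InnerProductSpace ℂ L]
theorem inner_prodFamily_single {I : Type*} [Finite I] [DecidableEq I] (i : I)
    (η : lp (fun _ : ℕ => L) 2) (v : lp (fun _ : I × ℕ => L) 2) :
    inner ℂ (prodFamily (Pi.single i η)) v = ∑' n, inner ℂ (η n) (v (i, n)) := by
  rw [lp.inner_eq_tsum]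
  apply tsum_eq_tsum_of_ne_zero_bij
    (fun n : Function.support fun n => inner ℂ (η n) (v (i, n)) => (i, (n : ℕ)))
  · intro a b hab
    exact Subtype.ext (by simpa using hab)
  · rintro ⟨j, n⟩ hj
    by_cases h : j = i
    · subst h
      simp only [prodFamily_apply, Function.mem_support, Pi.single_eq_same] at hj
      exact ⟨⟨n, hj⟩, rfl⟩
    · exact absurd (by simp [h]) hj
  · simp

variable [CompleteSpace H] [CompleteSpace L]

/-- The essential part of the double commutant theorem, on an ampliation: each vector of the
essential subspace of a *-algebra of operators lies in the closure of its orbit. -/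
theorem mem_closure_ampliation (N : Submodule ℂ (L →L[ℂ] L))
    (hmul : ∀ a ∈ N, ∀ b ∈ N, a ∘L b ∈ N) (hstar : ∀ a ∈ N, adjoint a ∈ N)
    (ζ : lp (fun _ : ι => L) 2)
    (hζ : ∀ i, ∀ k : L, (∀ a ∈ N, a k = 0) → inner ℂ k (ζ i) = 0) :
    ζ ∈ closure {v | ∃ a ∈ N, ampliation ι a ζ = v} := by
  set W : Submodule ℂ (lp (fun _ : ι => L) 2) :=
    { carrier := {v | ∃ a ∈ N, ampliation ι a ζ = v}
      add_mem' := by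
        rintro _ _ ⟨a, ha, rfl⟩ ⟨b, hb, rfl⟩
        exact ⟨a + b, N.add_mem ha hb, by ext; simp⟩
      zero_mem' := ⟨0, N.zero_mem, by ext; simp⟩
      smul_mem' := by
        rintro c _ ⟨a, ha, rfl⟩
        exact ⟨c • a, N.smul_mem c ha, by ext; simp⟩ } with hW
  have hperp : ∀ a ∈ N, ∀ δ ∈ Wᗮ, ampliation ι a δ ∈ Wᗮ := by
    rintro a ha δ hδ
    rw [Submodule.mem_orthogonal]
    rintro _ ⟨b, hb, rfl⟩
    rw [inner_ampliation]
    exact (Submodule.mem_orthogonal _ _).1 hδ _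
      ⟨adjoint a ∘L b, hmul _ (hstar a ha) _ hb, by ext; simp⟩
  have hperp2 : ∀ a ∈ N, ∀ δ ∈ Wᗮᗮ, ampliation ι a δ ∈ Wᗮᗮ := by
    rintro a ha δ hδ
    rw [Submodule.mem_orthogonal]
    intro δ' hδ'
    rw [inner_ampliation]
    exact (Submodule.mem_orthogonal _ _).1 hδ _ (hperp _ (hstar a ha) _ hδ')
  obtain ⟨δ, hδ, w, hw, hsum⟩ : ∃ δ ∈ Wᗮ, ∃ w ∈ Wᗮᗮ, ζ = δ + w :=
    (Wᗮ).exists_add_mem_mem_orthogonal ζ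
  -- `a δ = a ζ - a w` lies in `Wᗮ` and in `Wᗮᗮ`.
  have hzero : ∀ a ∈ N, ∀ i, a (δ i) = 0 := by
    intro a ha i
    have h1 : ampliation ι a δ ∈ Wᗮᗮ := by
      have : δ = ζ - w := by rw [hsum]; abel
      rw [this, map_sub]
      exact Submodule.sub_mem _ (Submodule.le_orthogonal_orthogonal W ⟨a, ha, rfl⟩)
        (hperp2 a ha w hw)
    have h2 : ampliation ι a δ = 0 :=
      inner_self_eq_zero.1 ((Submodule.mem_orthogonal _ _).1 h1 _ (hperp a ha δ hδ))
    rw [← ampliation_apply, h2]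
    rfl
  have hδζ : inner ℂ δ ζ = 0 := by
    rw [lp.inner_eq_tsum]
    simp [fun i => hζ i (δ i) fun a ha => hzero a ha i]
  have hδ0 : δ = 0 := by
    rw [hsum, inner_add_right, (Submodule.mem_orthogonal _ _).1 hw δ hδ, add_zero] at hδζ
    exact inner_self_eq_zero.1 hδζ
  have : ζ ∈ Wᗮᗮ := by rw [hsum, hδ0, zero_add]; exact hw
  rw [Submodule.orthogonal_orthogonal_eq_closure] at this
  exact this

/-- The w*-closed span of `N y` contains `y` if the range of `y` lies in the essential subspace of
the *-algebra `N`. Finitely many normal functionals are handled by one vector of an ampliation. -/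
theorem mem_wStarSpan_comp (N : Submodule ℂ (L →L[ℂ] L))
    (hmul : ∀ a ∈ N, ∀ b ∈ N, a ∘L b ∈ N) (hstar : ∀ a ∈ N, adjoint a ∈ N) (y : H →L[ℂ] L)
    (hy : ∀ k : L, (∀ a ∈ N, a k = 0) → adjoint y k = 0) :
    y ∈ wStarSpan {z | ∃ a ∈ N, z = a ∘L y} := by
  classical
  rw [wStarSpan, mem_wStar_closure_iff]
  intro I u hu
  set ζ : lp (fun _ : I × ℕ => L) 2 := ampliation _ y (prodFamily fun i : I => i.1.1) with hζ
  have hmem := mem_closure_ampliation N hmul hstar ζ (by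
    intro i k hk
    rw [hζ, ampliation_apply, ← adjoint_inner_left, hy k hk, inner_zero_left])
  have key : ∀ (i : I) (a : L →L[ℂ] L), normalFunctional i.1.1 i.1.2 (a ∘L y) =
      inner ℂ (prodFamily (Pi.single i i.1.2)) (ampliation _ a ζ) := by
    intro i a
    rw [inner_prodFamily_single]
    rfl
  have key1 : ∀ (i : I), normalFunctional i.1.1 i.1.2 y =
      inner ℂ (prodFamily (Pi.single i i.1.2)) ζ := by
    intro i 
    rw [inner_prodFamily_single]
    rfl
  rw [mem_closure_iff] at hmem
  obtain ⟨_, hv, a, ha, rfl⟩ := hmem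
    (⋂ i : I, (fun v => inner ℂ (prodFamily (Pi.single i i.1.2)) v) ⁻¹' (u i.1))
    (isOpen_iInter_of_finite fun i => (hu i.1 i.2).1.preimage (by fun_prop))
    (by
      simp only [Set.mem_iInter, Set.mem_preimage]
      intro i
      rw [← key1]
      exact (hu i.1 i.2).2)
  refine ⟨a ∘L y, Submodule.subset_span ⟨a, ha, rfl⟩, fun i hi => ?_⟩
  simp only [Set.mem_iInter, Set.mem_preimage] at hv
  have := hv ⟨i, hi⟩
  rwa [← key] at this

end Density

/-! ### Operators on a Hilbert space: extension, order, strong limits -/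

section Operators

theorem inner_re_mono {H : Type*} [NormedAddCommGroup H] [InnerProductSpace ℂ H]
    {S T : H →L[ℂ] H} (h : S ≤ T) (ξ : H) :
    RCLike.re (inner ℂ ξ (S ξ)) ≤ RCLike.re (inner ℂ ξ (T ξ)) := by
  have := ((le_def _ _).1 h).re_inner_nonneg_right ξ
  simpa [inner_sub_right] using this

open scoped ComplexOrder in
theorem le_of_tendsto_apply {α : Type*} {l : Filter α} [l.NeBot]
    {H : Type*} [NormedAddCommGroup H] [InnerProductSpace ℂ H] {S T : α → H →L[ℂ] H}
    {S₀ T₀ : H →L[ℂ] H} (hS : ∀ ξ, Filter.Tendsto (fun i => S i ξ) l (nhds (S₀ ξ)))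
    (hT : ∀ ξ, Filter.Tendsto (fun i => T i ξ) l (nhds (T₀ ξ))) (h : ∀ᶠ i in l, S i ≤ T i) :
    S₀ ≤ T₀ := by
  rw [le_def, isPositive_iff_complex]
  intro ξ
  have hlim : Filter.Tendsto (fun i => inner ℂ ((T i - S i) ξ) ξ) l
      (nhds (inner ℂ ((T₀ - S₀) ξ) ξ)) := by
    simp only [sub_apply]
    exact ((hT ξ).sub (hS ξ)).inner tendsto_const_nhds
  have h1 : 0 ≤ inner ℂ ((T₀ - S₀) ξ) ξ := by
    refine ge_of_tendsto hlim ?_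
    filter_upwards [h] with i hi
    exact ((le_def _ _).1 hi).inner_nonneg_left ξ
  exact RCLike.nonneg_iff_exists_ofReal.1 h1 |>.elim fun r hr => by
    rw [← hr.2]; simpa using hr.1

variable {H K : Type*} [NormedAddCommGroup H] [InnerProductSpace ℂ H] [CompleteSpace H]
  [NormedAddCommGroup K] [InnerProductSpace ℂ K] [CompleteSpace K]

/-- If `‖Ψ v‖ ≤ C ‖Φ v‖` for all `v`, then `Φ v ↦ Ψ v` extends to a bounded operator that vanishes
on the orthogonal complement of the range of `Φ`. -/
theorem exists_clm_of_norm_le {V : Type*} [AddCommGroup V] [Module ℂ V] (Φ : V →ₗ[ℂ] H)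
    (Ψ : V →ₗ[ℂ] K) (C : ℝ) (h : ∀ v, ‖Ψ v‖ ≤ C * ‖Φ v‖) :
    ∃ T : H →L[ℂ] K, (∀ v, T (Φ v) = Ψ v) ∧ ∀ ξ ∈ (LinearMap.range Φ)ᗮ, T ξ = 0 := by
  set W := (LinearMap.range Φ).topologicalClosure with hW
  have hmem : ∀ v, Φ v ∈ W := fun v => Submodule.le_topologicalClosure _ ⟨v, rfl⟩
  let e : V →ₗ[ℂ] W := Φ.codRestrict W hmem
  have hd : DenseRange e := by
    intro w
    rw [closure_subtype]
    have : ((↑) '' Set.range e : Set H) = LinearMap.range Φ := by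
      ext x
      simp [e, LinearMap.codRestrict_apply]
    rw [this]
    exact w.2
  have : CompleteSpace W := (Submodule.isClosed_topologicalClosure _).completeSpace_coe
  refine ⟨Ψ.extendOfNorm e ∘L W.orthogonalProjectionOnto, fun v => ?_, fun ξ hξ => ?_⟩
  · have h1 : W.orthogonalProjectionOnto (Φ v) = e v :=
      W.orthogonalProjectionOnto_mem_subspace_eq_self (e v)
    rw [comp_apply, h1, LinearMap.extendOfNorm_eq hd ⟨C, fun v => h v⟩]
  · have h1 : W.orthogonalProjectionOnto ξ = 0 := by
      rw [Submodule.orthogonalProjectionOnto_eq_zero_iff, hW, Submodule.orthogonal_closure]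
      exact hξ
    rw [comp_apply, h1, map_zero]

theorem norm_sq_apply_le_of_nonneg {T : H →L[ℂ] H} (hT : 0 ≤ T) (ξ : H) :
    ‖T ξ‖ ^ 2 ≤ ‖T‖ * RCLike.re (inner ℂ ξ (T ξ)) := by
  set S := CFC.sqrt T with hS
  have h1 : S * S = T := CFC.sqrt_mul_sqrt_self T hT
  have h2 : star S = S := (CFC.sqrt_nonneg T).isSelfAdjoint.star_eq
  have h3 : ‖S ξ‖ ^ 2 = RCLike.re (inner ℂ ξ (T ξ)) := by
    rw [← h1, mul_apply_eq_comp, ← adjoint_inner_left, ← star_eq_adjoint, h2,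
      inner_self_eq_norm_sq]
  have h4 : ‖S‖ ^ 2 = ‖T‖ := by
    rw [← h1, sq, ← CStarRing.norm_star_mul_self, h2]
  rw [← h3, ← h4, ← mul_pow]
  refine pow_le_pow_left₀ (norm_nonneg _) ?_ 2
  rw [← h1]
  exact S.le_opNorm _

theorem norm_sq_sub_apply_le {x y b : H →L[ℂ] H} (h0 : 0 ≤ x) (hxy : x ≤ y) (hyb : y ≤ b) (ξ : H) :
    ‖y ξ - x ξ‖ ^ 2 ≤
      ‖b‖ * (RCLike.re (inner ℂ ξ (y ξ)) - RCLike.re (inner ℂ ξ (x ξ))) := by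
  have hd : 0 ≤ y - x := sub_nonneg.2 hxy
  have h2 := norm_sq_apply_le_of_nonneg hd ξ
  have h3 : ‖y - x‖ ≤ ‖b‖ :=
    CStarAlgebra.norm_le_norm_of_nonneg_of_le hd ((sub_le_self _ h0).trans hyb)
  rw [sub_apply, inner_sub_right, map_sub] at h2
  exact h2.trans (mul_le_mul_of_nonneg_right h3 (sub_nonneg.2 (inner_re_mono hxy ξ)))

/-- A chain of operators between `0` and `b` converges strongly to its least upper bound. -/
theorem exists_strong_limit_of_chain {c : Set (H →L[ℂ] H)} (hc : IsChain (· ≤ ·) c)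
    (hne : c.Nonempty) {b : H →L[ℂ] H} (h0 : ∀ x ∈ c, 0 ≤ x) (hb : ∀ x ∈ c, x ≤ b) :
    ∃ T : H →L[ℂ] H,
      (∀ ξ, Filter.Tendsto (fun x : c => (x : H →L[ℂ] H) ξ) Filter.atTop (nhds (T ξ))) ∧
      IsLUB c T := by
  have : Nonempty c := hne.to_subtype
  have : IsDirectedOrder c := ⟨fun x y => by
    rcases hc.total x.2 y.2 with h | h
    · exact ⟨y, h, le_rfl⟩
    · exact ⟨x, le_rfl, h⟩⟩
  have hnorm : ∀ x ∈ c, ‖x‖ ≤ ‖b‖ := fun x hx =>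
    CStarAlgebra.norm_le_norm_of_nonneg_of_le (h0 x hx) (hb x hx)
  have hcauchy : ∀ ξ, Cauchy (Filter.map (fun x : c => (x : H →L[ℂ] H) ξ) Filter.atTop) := by
    intro ξ
    let g : c → ℝ := fun x => RCLike.re (inner ℂ ξ ((x : H →L[ℂ] H) ξ))
    have hbdd : BddAbove (Set.range g) := by
      refine ⟨RCLike.re (inner ℂ ξ (b ξ)), ?_⟩
      rintro _ ⟨x, rfl⟩
      exact inner_re_mono (hb x x.2) ξ
    rw [Metric.cauchy_iff]
    refine ⟨inferInstance, fun ε hε => ?_⟩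
    obtain ⟨N, hN⟩ := exists_lt_of_lt_ciSup
      (show (⨆ x, g x) - (ε / 2) ^ 2 / (‖b‖ + 1) < ⨆ x, g x from
        sub_lt_self _ (by positivity))
    have key : ∀ n : c, N ≤ n → dist ((n : H →L[ℂ] H) ξ) ((N : H →L[ℂ] H) ξ) < ε / 2 := by
      intro n hn
      have hle : (N : H →L[ℂ] H) ≤ (n : H →L[ℂ] H) := hn
      have h2 := norm_sq_sub_apply_le (h0 N N.2) hle (hb n n.2) ξ
      rw [dist_eq_norm]
      refine lt_of_pow_lt_pow_left₀ 2 (by positivity) (h2.trans_lt ?_)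
      have h3 : g n - g N < (ε / 2) ^ 2 / (‖b‖ + 1) := by
        have := le_ciSup hbdd n
        linarith
      rw [lt_div_iff₀ (by positivity)] at h3
      have h4 : g N ≤ g n := inner_re_mono hle ξ
      change ‖b‖ * (g n - g N) < _
      nlinarith [norm_nonneg b]
    refine ⟨(fun x : c => (x : H →L[ℂ] H) ξ) '' Set.Ici N,
      Filter.image_mem_map (Filter.Ici_mem_atTop N), ?_⟩
    rintro _ ⟨n, hn, rfl⟩ _ ⟨m, hm, rfl⟩
    have := dist_triangle_right ((n : H →L[ℂ] H) ξ) ((m : H →L[ℂ] H) ξ) ((N : H →L[ℂ] H) ξ)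
    linarith [key n hn, key m hm]
  choose f hf using fun ξ => CompleteSpace.complete (hcauchy ξ)
  replace hf : ∀ ξ, Filter.Tendsto (fun x : c => (x : H →L[ℂ] H) ξ) Filter.atTop (nhds (f ξ)) := hf
  let T : H →L[ℂ] H := LinearMap.mkContinuous
    { toFun := f
      map_add' := fun x y => tendsto_nhds_unique (hf (x + y)) (by
        simpa using (hf x).add (hf y))
      map_smul' := fun a x => tendsto_nhds_unique (hf (a • x)) (by
        simpa using (hf x).const_smul a) } ‖b‖ fun ξ =>
      le_of_tendsto (hf ξ).norm (Filter.Eventually.of_forall fun x =>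
        (x : H →L[ℂ] H).le_of_opNorm_le (hnorm x x.2) ξ)
  have hT : ∀ ξ, Filter.Tendsto (fun x : c => (x : H →L[ℂ] H) ξ) Filter.atTop (nhds (T ξ)) := hf
  refine ⟨T, hT, fun x hx => ?_, fun y hy => ?_⟩
  · refine le_of_tendsto_apply (fun _ => tendsto_const_nhds) hT ?_
    filter_upwards [Filter.eventually_ge_atTop (⟨x, hx⟩ : c)] with z hz using hz
  · exact le_of_tendsto_apply hT (fun _ => tendsto_const_nhds)
      (Filter.Eventually.of_forall fun z => hy z.2)

end Operators

/-! ### Intertwiners of isomorphisms of commutants -/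

section Commutant

theorem clm_ext_of_orthogonal {H K : Type*} [NormedAddCommGroup H] [InnerProductSpace ℂ H]
    [CompleteSpace H] [NormedAddCommGroup K] [InnerProductSpace ℂ K]
    (U : Submodule ℂ H) {S T : H →L[ℂ] K} (h : ∀ u ∈ U, S u = T u)
    (h' : ∀ u ∈ Uᗮ, S u = T u) : S = T := by
  have hcl : ∀ u ∈ U.topologicalClosure, S u = T u := fun u hu =>
    (isClosed_eq S.continuous T.continuous).closure_subset_iff.2 h hu
  have : CompleteSpace U.topologicalClosure :=
    (Submodule.isClosed_topologicalClosure _).completeSpace_coe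
  ext v
  obtain ⟨a, ha, b, hb, rfl⟩ := U.topologicalClosure.exists_add_mem_mem_orthogonal v
  rw [Submodule.orthogonal_closure] at hb
  rw [map_add, map_add, hcl a ha, h' b hb]

variable {H K : Type*} [NormedAddCommGroup H] [InnerProductSpace ℂ H] [CompleteSpace H]
  [NormedAddCommGroup K] [InnerProductSpace ℂ K] [CompleteSpace K]

theorem mem_centralizer_iff_of_star {D : Set (H →L[ℂ] H)} (hD : ∀ d ∈ D, star d ∈ D)
    {x : H →L[ℂ] H} :
    x ∈ StarSubalgebra.centralizer ℂ D ↔ ∀ d ∈ D, d * x = x * d := by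
  rw [StarSubalgebra.mem_centralizer_iff]
  exact ⟨fun h a ha => (h a ha).1, fun h a ha => ⟨h a ha, h _ (hD a ha)⟩⟩

theorem starProjection_mem_centralizer {D : Set (H →L[ℂ] H)} (hD : ∀ d ∈ D, star d ∈ D)
    (U : Submodule ℂ H) [U.HasOrthogonalProjection] (hU : ∀ d ∈ D, ∀ u ∈ U, d u ∈ U) :
    U.starProjection ∈ StarSubalgebra.centralizer ℂ D := by
  rw [mem_centralizer_iff_of_star hD]
  intro d hd
  refine clm_ext_of_orthogonal U (fun u hu => ?_) fun u hu => ?_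
  · rw [mul_apply_eq_comp, mul_apply_eq_comp, Submodule.starProjection_eq_self_iff.2 hu,
      Submodule.starProjection_eq_self_iff.2 (hU d hd u hu)]
  · have : d u ∈ Uᗮ := by
      rw [Submodule.mem_orthogonal]
      intro v hv
      rw [← adjoint_inner_left]
      exact (Submodule.mem_orthogonal _ _).1 hu _ (hU _ (hD d hd) v hv)
    rw [mul_apply_eq_comp, mul_apply_eq_comp, Submodule.starProjection_apply_eq_zero_iff U |>.2 hu,
      Submodule.starProjection_apply_eq_zero_iff U |>.2 this, map_zero]

theorem sqrt_mem_centralizer {D : Set (H →L[ℂ] H)} {x : H →L[ℂ] H}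
    (hx : x ∈ StarSubalgebra.centralizer ℂ D) : CFC.sqrt x ∈ StarSubalgebra.centralizer ℂ D := by
  rw [StarSubalgebra.mem_centralizer_iff] at hx ⊢
  have key : ∀ d, d * x = x * d → d * CFC.sqrt x = CFC.sqrt x * d := fun d hd =>
    ((show Commute x d from hd.symm).cfcₙ_nnreal NNReal.sqrt).symm
  exact fun d hd => ⟨key _ (hx d hd).1, key _ (hx d hd).2⟩

theorem exists_sqrt_of_nonneg {D : Set (H →L[ℂ] H)} {x : StarSubalgebra.centralizer ℂ D}
    (hx : 0 ≤ (x : H →L[ℂ] H)) :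
    ∃ s : StarSubalgebra.centralizer ℂ D, star s = s ∧ s * s = x :=
  ⟨⟨CFC.sqrt x, sqrt_mem_centralizer x.2⟩,
    Subtype.ext (CFC.sqrt_nonneg (x : H →L[ℂ] H)).isSelfAdjoint.star_eq,
    Subtype.ext (CFC.sqrt_mul_sqrt_self _ hx)⟩

theorem re_inner_star_mul_self (x : H →L[ℂ] H) (ξ : H) :
    RCLike.re (inner ℂ ξ ((star x * x) ξ)) = ‖x ξ‖ ^ 2 := by
  rw [mul_apply_eq_comp, star_eq_adjoint, adjoint_inner_right, inner_self_eq_norm_sq]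

/-- A maximality argument comparing an additive functional `φ` with a vector state `⟪η, · η⟫`. No
continuity of `φ` is needed, since the vector state is normal. -/
theorem exists_forall_le_inner {D : Set (H →L[ℂ] H)} (hD : ∀ d ∈ D, star d ∈ D)
    (φ : StarSubalgebra.centralizer ℂ D → ℝ)
    (hadd : ∀ x y, φ (x + y) = φ x + φ y)
    (hmono : ∀ x y : StarSubalgebra.centralizer ℂ D, (x : H →L[ℂ] H) ≤ y → φ x ≤ φ y)
    (e : StarSubalgebra.centralizer ℂ D) (he : 0 ≤ (e : H →L[ℂ] H)) (η : H)
    (hη : φ e < RCLike.re (inner ℂ η ((e : H →L[ℂ] H) η))) :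
    ∃ y : StarSubalgebra.centralizer ℂ D, 0 ≤ (y : H →L[ℂ] H) ∧ (y : H →L[ℂ] H) ≤ e ∧ y ≠ 0 ∧
      ∀ z : StarSubalgebra.centralizer ℂ D, 0 ≤ (z : H →L[ℂ] H) → (z : H →L[ℂ] H) ≤ y →
        φ z ≤ RCLike.re (inner ℂ η ((z : H →L[ℂ] H) η)) := by
  let f : (H →L[ℂ] H) → ℝ := fun x => RCLike.re (inner ℂ η (x η))
  let C : Set (H →L[ℂ] H) := {x | ∃ h : x ∈ StarSubalgebra.centralizer ℂ D,
    0 ≤ x ∧ x ≤ e ∧ f x ≤ φ ⟨x, h⟩}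
  have hφ0 : φ 0 = 0 := by simpa using hadd 0 0
  have h0C : (0 : H →L[ℂ] H) ∈ C := ⟨zero_mem _, le_rfl, he, by
    simp [f, show (⟨0, zero_mem _⟩ : StarSubalgebra.centralizer ℂ D) = 0 from rfl, hφ0]⟩
  -- A strong limit `T` of a chain in `C` stays in `C`: `f` is continuous along the chain, and for
  -- `φ` the inequality `φ x ≤ φ T` suffices.
  obtain ⟨x₀, -, hx₀⟩ := zorn_le_nonempty₀ C (by
    intro c hcC hc x hx
    obtain ⟨T, hT, hle⟩ := exists_strong_limit_of_chain hc ⟨x, hx⟩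
      (fun x hx => (hcC hx).2.1) (b := e) (fun x hx => (hcC hx).2.2.1)
    have : Nonempty c := ⟨⟨x, hx⟩⟩
    have : IsDirectedOrder c := ⟨fun x y => by
      rcases hc.total x.2 y.2 with h | h
      · exact ⟨y, h, le_rfl⟩
      · exact ⟨x, le_rfl, h⟩⟩
    have hTR : T ∈ StarSubalgebra.centralizer ℂ D := by
      rw [mem_centralizer_iff_of_star hD]
      intro d hd
      ext ξ
      refine tendsto_nhds_unique ((d.continuous.tendsto _).comp (hT ξ)) ?_
      refine (hT (d ξ)).congr fun x => ?_
      have := (mem_centralizer_iff_of_star hD).1 (hcC x.2).1 d hd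
      exact (congrArg (fun a : H →L[ℂ] H => a ξ) this).symm
    refine ⟨T, ⟨hTR, ((hcC hx).2.1).trans (hle.1 hx), hle.2 fun x hx => (hcC hx).2.2.1, ?_⟩,
      fun _ h => hle.1 h⟩
    · have h1 : Filter.Tendsto (fun x : c => f x) Filter.atTop (nhds (f T)) :=
        (RCLike.continuous_re.tendsto _).comp (tendsto_const_nhds.inner (hT η))
      exact le_of_tendsto h1 (Filter.Eventually.of_forall fun x =>
        (hcC x.2).2.2.2.trans (hmono _ _ (hle.1 x.2)))) 0 h0C
  obtain ⟨hx₀R, hx₀0, hx₀e, hx₀f⟩ := hx₀.prop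
  let y : StarSubalgebra.centralizer ℂ D := e - ⟨x₀, hx₀R⟩
  have hy : (y : H →L[ℂ] H) = e - x₀ := rfl
  refine ⟨y, by rw [hy]; exact sub_nonneg.2 hx₀e, by rw [hy]; exact sub_le_self _ hx₀0, ?_, ?_⟩
  · intro hy0
    have h1 : e = ⟨x₀, hx₀R⟩ := sub_eq_zero.1 hy0
    have h2 : (e : H →L[ℂ] H) = x₀ := congrArg Subtype.val h1
    rw [← h1] at hx₀f
    rw [h2] at hη
    exact absurd hx₀f (not_le.2 hη)
  · intro z hz0 hzy
    by_contra! hz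
    have hmem : x₀ + z ∈ C := by
      refine ⟨add_mem hx₀R z.2, add_nonneg hx₀0 hz0, ?_, ?_⟩
      · rw [hy] at hzy
        have := add_le_add_right hzy x₀
        rwa [add_sub_cancel] at this
      · have : φ ⟨x₀ + z, add_mem hx₀R z.2⟩ = φ ⟨x₀, hx₀R⟩ + φ z := hadd ⟨x₀, hx₀R⟩ z
        rw [this]
        have h2 : f (x₀ + z) = f x₀ + f z := by simp [f]
        rw [h2]
        exact add_le_add hx₀f hz.le
    have h1 : x₀ + z ≤ x₀ := hx₀.le_of_ge hmem (le_add_of_nonneg_right hz0)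
    have h2 : (z : H →L[ℂ] H) = 0 := le_antisymm (by simpa using h1) hz0
    have h3 : z = 0 := Subtype.ext h2
    rw [h3] at hz
    simp [hφ0] at hz

/-- If `‖θ(x) k‖ ≤ ‖x ξ‖` for all `x`, then `x ξ ↦ θ(x) k` extends to an intertwiner. -/
theorem exists_intertwiner_of_norm_le {D : Set (H →L[ℂ] H)} {D' : Set (K →L[ℂ] K)}
    (θ : StarSubalgebra.centralizer ℂ D ≃⋆ₐ[ℂ] StarSubalgebra.centralizer ℂ D') {ξ : H} {k : K}
    (hbound : ∀ x : StarSubalgebra.centralizer ℂ D,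
      ‖(θ x : K →L[ℂ] K) k‖ ≤ ‖(x : H →L[ℂ] H) ξ‖) :
    ∃ m : H →L[ℂ] K, (∀ x : StarSubalgebra.centralizer ℂ D,
      (θ x : K →L[ℂ] K) ∘L m = m ∘L (x : H →L[ℂ] H)) ∧ m ξ = k := by
  let Φ : StarSubalgebra.centralizer ℂ D →ₗ[ℂ] H :=
    { toFun := fun x => (x : H →L[ℂ] H) ξ
      map_add' := fun _ _ => rfl
      map_smul' := fun _ _ => rfl }
  let Ψ : StarSubalgebra.centralizer ℂ D →ₗ[ℂ] K :=
    { toFun := fun x => (θ x : K →L[ℂ] K) k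
      map_add' := fun x y => by simp
      map_smul' := fun c x => by simp }
  have hΦ : ∀ x, Φ x = (x : H →L[ℂ] H) ξ := fun _ => rfl
  have hΨ : ∀ x, Ψ x = (θ x : K →L[ℂ] K) k := fun _ => rfl
  obtain ⟨m, hm, hm0⟩ := exists_clm_of_norm_le Φ Ψ 1 fun x => by
    rw [hΦ, hΨ, one_mul]; exact hbound x
  refine ⟨m, fun x => clm_ext_of_orthogonal (LinearMap.range Φ) ?_ fun u hu => ?_, ?_⟩
  · rintro _ ⟨z, rfl⟩
    have h1 : (x : H →L[ℂ] H) (Φ z) = Φ (x * z) := rfl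
    rw [comp_apply, comp_apply, hm z, h1, hm, hΨ, hΨ, map_mul]
    rfl
  · have h1 : (x : H →L[ℂ] H) u ∈ (LinearMap.range Φ)ᗮ := by
      rw [Submodule.mem_orthogonal]
      rintro _ ⟨z, rfl⟩
      rw [← adjoint_inner_left]
      exact (Submodule.mem_orthogonal _ _).1 hu _ ⟨star x * z, rfl⟩
    rw [comp_apply, comp_apply, hm0 u hu, hm0 _ h1, map_zero]
  · have h1 := hm 1
    rw [hΦ, hΨ, map_one] at h1
    exact h1

/-- Domination of the state of `k` by the state of `η` on the operators between `0` and `h²` gives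
a norm estimate on the vectors `x h η`, because `h x* x h ≤ ‖x‖² h²`. -/
theorem norm_map_apply_le_of_forall_le {D : Set (H →L[ℂ] H)} {D' : Set (K →L[ℂ] K)}
    (θ : StarSubalgebra.centralizer ℂ D ≃⋆ₐ[ℂ] StarSubalgebra.centralizer ℂ D') {η : H} {k : K}
    {h : StarSubalgebra.centralizer ℂ D} (hstar : star h = h)
    (hle : ∀ z : StarSubalgebra.centralizer ℂ D, 0 ≤ (z : H →L[ℂ] H) →
      (z : H →L[ℂ] H) ≤ ((h * h : StarSubalgebra.centralizer ℂ D) : H →L[ℂ] H) →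
        RCLike.re (inner ℂ k ((θ z : K →L[ℂ] K) k)) ≤ RCLike.re (inner ℂ η ((z : H →L[ℂ] H) η)))
    (x : StarSubalgebra.centralizer ℂ D) :
    ‖(θ x : K →L[ℂ] K) ((θ h : K →L[ℂ] K) k)‖ ≤ ‖(x : H →L[ℂ] H) ((h : H →L[ℂ] H) η)‖ := by
  -- By homogeneity, `x` may be replaced by the contraction `r x`.
  obtain ⟨r, hr0, hr⟩ : ∃ r : ℝ, 0 < r ∧ r * ‖(x : H →L[ℂ] H)‖ ≤ 1 :=
    ⟨(‖(x : H →L[ℂ] H)‖ + 1)⁻¹, by positivity, by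
      rw [inv_mul_le_iff₀ (by positivity)]; linarith⟩
  let x' : StarSubalgebra.centralizer ℂ D := (r : ℂ) • x
  have hx'1 : star (x' : H →L[ℂ] H) * (x' : H →L[ℂ] H) ≤ 1 := by
    rw [← CStarAlgebra.norm_le_one_iff_of_nonneg _ (star_mul_self_nonneg _),
      CStarRing.norm_star_mul_self]
    have : ‖(x' : H →L[ℂ] H)‖ ≤ 1 := by
      change ‖(r : ℂ) • (x : H →L[ℂ] H)‖ ≤ 1
      rwa [norm_smul, Complex.norm_real, Real.norm_of_nonneg hr0.le]
    exact mul_le_one₀ this (norm_nonneg _) this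
  have h1 := hle (star (x' * h) * (x' * h))
    (star_mul_self_nonneg ((x' * h : StarSubalgebra.centralizer ℂ D) : H →L[ℂ] H)) (by
    have h2 := star_left_conjugate_le_conjugate hx'1 (h : H →L[ℂ] H)
    have h3 : star (h : H →L[ℂ] H) = h := congrArg Subtype.val hstar
    have h4 : ((star (x' * h) * (x' * h) : StarSubalgebra.centralizer ℂ D) : H →L[ℂ] H) =
      star (h : H →L[ℂ] H) * (star (x' : H →L[ℂ] H) * (x' : H →L[ℂ] H)) * h := by
      rw [star_mul]
      simp only [mul_assoc]
      rfl
    rw [h4]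
    refine h2.trans_eq ?_
    rw [mul_one, h3]
    rfl)
  have h5 : (θ (star (x' * h) * (x' * h)) : K →L[ℂ] K) =
      star (θ (x' * h) : K →L[ℂ] K) * (θ (x' * h) : K →L[ℂ] K) := by
    rw [map_mul, map_star]
    rfl
  have h6 : ((star (x' * h) * (x' * h) : StarSubalgebra.centralizer ℂ D) : H →L[ℂ] H) =
      star ((x' * h : StarSubalgebra.centralizer ℂ D) : H →L[ℂ] H) *
        ((x' * h : StarSubalgebra.centralizer ℂ D) : H →L[ℂ] H) := rfl
  rw [h5, h6, re_inner_star_mul_self, re_inner_star_mul_self] at h1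
  have h7 := abs_le_of_sq_le_sq h1 (norm_nonneg _) |> (le_abs_self _).trans
  have h8 : (θ (x' * h) : K →L[ℂ] K) k = (r : ℂ) • (θ x : K →L[ℂ] K) ((θ h : K →L[ℂ] K) k) := by
    rw [map_mul, map_smul]
    rfl
  have h9 : ((x' * h : StarSubalgebra.centralizer ℂ D) : H →L[ℂ] H) η =
      (r : ℂ) • (x : H →L[ℂ] H) ((h : H →L[ℂ] H) η) := rfl
  rw [h8, h9, norm_smul, norm_smul] at h7
  exact le_of_mul_le_mul_left h7 (by simpa using hr0.ne')

/-- Intertwiners of an isomorphism `θ` of commutants separate the points of `H`. -/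
theorem eq_zero_of_forall_intertwiner {D : Set (H →L[ℂ] H)} {D' : Set (K →L[ℂ] K)}
    (hD : ∀ d ∈ D, star d ∈ D) (hD' : ∀ d ∈ D', star d ∈ D')
    (θ : StarSubalgebra.centralizer ℂ D ≃⋆ₐ[ℂ] StarSubalgebra.centralizer ℂ D') {ξ : H}
    (hξ : ∀ m : H →L[ℂ] K, (∀ x : StarSubalgebra.centralizer ℂ D,
      (θ x : K →L[ℂ] K) ∘L m = m ∘L (x : H →L[ℂ] H)) → m ξ = 0) : ξ = 0 := by
  by_contra hξ0
  let E : Submodule ℂ H :=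
    ⨅ m : {m : H →L[ℂ] K // ∀ x : StarSubalgebra.centralizer ℂ D,
      (θ x : K →L[ℂ] K) ∘L m = m ∘L (x : H →L[ℂ] H)}, m.1.ker
  have hE : ∀ v, v ∈ E ↔ ∀ m : H →L[ℂ] K, (∀ x : StarSubalgebra.centralizer ℂ D,
      (θ x : K →L[ℂ] K) ∘L m = m ∘L (x : H →L[ℂ] H)) → m v = 0 := by
    intro v
    simp [E, Submodule.mem_iInf]
  have hEcl : IsClosed (E : Set H) := by
    rw [Submodule.coe_iInf]
    exact isClosed_iInter fun m => m.1.isClosed_ker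
  have : CompleteSpace E := hEcl.completeSpace_coe
  let e : StarSubalgebra.centralizer ℂ D := ⟨E.starProjection,
    starProjection_mem_centralizer hD E fun d hd u hu => by
      rw [hE] at hu ⊢
      intro m hm
      refine hu (m ∘L d) fun x => ?_
      have hx : d * (x : H →L[ℂ] H) = x * d := (mem_centralizer_iff_of_star hD).1 x.2 d hd
      rw [← comp_assoc, hm x, comp_assoc, comp_assoc]
      exact congrArg (m ∘L ·) hx.symm⟩
  have heξ : (e : H →L[ℂ] H) ξ = ξ :=
    Submodule.starProjection_eq_self_iff.2 ((hE ξ).2 hξ)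
  have heE : ∀ v, (e : H →L[ℂ] H) v ∈ E := fun v => Submodule.starProjection_apply_mem E v
  have hee : e * e = e := Subtype.ext E.isIdempotentElem_starProjection.eq
  -- A nonzero vector `k` in the range of `θ e`.
  obtain ⟨k, hk0, hk⟩ : ∃ k : K, k ≠ 0 ∧ (θ e : K →L[ℂ] K) k = k := by
    have h1 : (θ e : K →L[ℂ] K) ≠ 0 := by
      intro h
      have h2 : θ e = 0 := Subtype.ext h
      have h3 : e = 0 := by simpa using h2
      rw [h3] at heξ
      exact hξ0 heξ.symm
    obtain ⟨k₀, hk₀⟩ := exists_ne_zero h1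
    refine ⟨_, hk₀, ?_⟩
    have := congrArg θ hee
    rw [map_mul] at this
    exact congrArg (fun a : StarSubalgebra.centralizer ℂ D' => (a : K →L[ℂ] K) k₀) this
  -- The support projection `s` of the vector state of `k` on the commutant of `D'`.
  let N := Subalgebra.centralizer ℂ (StarSubalgebra.centralizer ℂ D' : Set (K →L[ℂ] K))
  let W : Submodule ℂ K := N.toSubmodule.map (ContinuousLinearMap.apply ℂ K k : (K →L[ℂ] K) →ₗ[ℂ] K)
  let V := W.topologicalClosure
  have : CompleteSpace V := (Submodule.isClosed_topologicalClosure _).completeSpace_coe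
  have hDN : ∀ d ∈ D', d ∈ N := by
    intro d hd
    rw [Subalgebra.mem_centralizer_iff]
    intro x hx
    exact ((mem_centralizer_iff_of_star hD').1 hx d hd).symm
  let s : StarSubalgebra.centralizer ℂ D' := ⟨V.starProjection,
    starProjection_mem_centralizer hD' V fun d hd u hu => by
      refine map_mem_closure d.continuous hu ?_
      rintro v ⟨a, ha, rfl⟩
      exact ⟨d * a, N.mul_mem (hDN d hd) ha, rfl⟩⟩
  have hsk : (s : K →L[ℂ] K) k = k :=
    Submodule.starProjection_eq_self_iff.2 (Submodule.le_topologicalClosure _ ⟨1, N.one_mem, rfl⟩)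
  -- Operators of the commutant that agree at `k` agree on the range of `s`.
  have hsupp : ∀ a b : StarSubalgebra.centralizer ℂ D', (a : K →L[ℂ] K) k = (b : K →L[ℂ] K) k →
      a * s = b * s := by
    intro a b hab
    refine Subtype.ext ?_
    ext v
    have hcl : ∀ u ∈ V, (a : K →L[ℂ] K) u = (b : K →L[ℂ] K) u := by
      intro u hu
      refine (isClosed_eq (a : K →L[ℂ] K).continuous
        (b : K →L[ℂ] K).continuous).closure_subset_iff.2 ?_ hu
      rintro _ ⟨c, hc, rfl⟩
      have h1 := (Subalgebra.mem_centralizer_iff ℂ).1 hc a a.2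
      have h2 := (Subalgebra.mem_centralizer_iff ℂ).1 hc b b.2
      have h3 := congrArg (fun x : K →L[ℂ] K => x k) h1
      have h4 := congrArg (fun x : K →L[ℂ] K => x k) h2
      exact h3.trans ((congrArg c hab).trans h4.symm)
    exact hcl _ (Submodule.starProjection_apply_mem V v)
  have hes : θ e * s = s := by
    rw [hsupp (θ e) 1 (by rw [hk]; rfl), one_mul]
  let e' := θ.symm s
  have hθe' : θ e' = s := θ.apply_symm_apply s
  have hs_proj : IsStarProjection (V.starProjection) := isStarProjection_starProjection
  have hss : s * s = s := Subtype.ext hs_proj.isIdempotentElem.eq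
  have hsstar : star s = s := Subtype.ext hs_proj.isSelfAdjoint.star_eq
  have he'proj : IsStarProjection (e' : H →L[ℂ] H) := by
    constructor
    · have : e' * e' = e' := EquivLike.injective θ (by rw [map_mul, hθe', hss])
      exact congrArg Subtype.val this
    · have : star e' = e' := EquivLike.injective θ (by rw [map_star, hθe', hsstar])
      exact congrArg Subtype.val this
  have hee' : e * e' = e' := EquivLike.injective θ (by rw [map_mul, hθe', hes])
  -- A vector `η` in the range of `e'` that is longer than `k`, so that `φ e' < ⟪η, e' η⟫`.
  obtain ⟨η, hη, hηk⟩ : ∃ η : H, (e' : H →L[ℂ] H) η = η ∧ ‖k‖ < ‖η‖ := by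
    have h1 : (e' : H →L[ℂ] H) ≠ 0 := by
      intro h
      have h2 : e' = 0 := Subtype.ext h
      have h3 : s = 0 := by rw [← hθe', h2, map_zero]
      rw [h3] at hsk
      exact hk0 hsk.symm
    obtain ⟨η₀, hη₀⟩ := exists_ne_zero h1
    obtain ⟨c, hc⟩ := NormedField.exists_lt_norm ℂ (‖k‖ / ‖(e' : H →L[ℂ] H) η₀‖)
    refine ⟨c • (e' : H →L[ℂ] H) η₀, ?_, ?_⟩
    · rw [map_smul, ← mul_apply_eq_comp, he'proj.isIdempotentElem.eq]
    · rw [norm_smul]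
      rwa [div_lt_iff₀ (norm_pos_iff.2 hη₀)] at hc
  let φ : StarSubalgebra.centralizer ℂ D → ℝ :=
    fun x => RCLike.re (inner ℂ k ((θ x : K →L[ℂ] K) k))
  have hφsq : ∀ x, φ (star x * x) = ‖(θ x : K →L[ℂ] K) k‖ ^ 2 := by
    intro x
    rw [← re_inner_star_mul_self]
    simp only [φ, map_mul, map_star]
    rfl
  have hφadd : ∀ x y, φ (x + y) = φ x + φ y := by
    intro x y
    simp [φ]
  obtain ⟨y, hy0, hye, hyne, hy⟩ := exists_forall_le_inner hD φ hφadd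
    (by
      intro x y hxy
      have hd : 0 ≤ ((y - x : StarSubalgebra.centralizer ℂ D) : H →L[ℂ] H) := sub_nonneg.2 hxy
      obtain ⟨t, ht, htt⟩ := exists_sqrt_of_nonneg hd
      have h1 := hφsq t
      rw [ht, htt] at h1
      have h2 := hφadd x (y - x)
      rw [add_sub_cancel, h1] at h2
      rw [h2]
      exact le_add_of_nonneg_right (sq_nonneg _))
    e' he'proj.nonneg η (by
      rw [hη, inner_self_eq_norm_sq]
      simp only [φ]
      rw [hθe', hsk, inner_self_eq_norm_sq]
      exact pow_lt_pow_left₀ hηk (norm_nonneg _) two_ne_zero)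
  obtain ⟨h, hstar, hhh⟩ := exists_sqrt_of_nonneg hy0
  have hye' : y * e' = y :=
    Subtype.ext (he'proj.mul_right_and_mul_left_of_nonneg_of_le hy0 hye).1
  have hhe' : e' * h = h := by
    have h1 : (1 - e') * h * star ((1 - e') * h) = 0 := by
      rw [star_mul, hstar, ← mul_assoc, mul_assoc (1 - e'), hhh, star_sub, star_one,
        show star e' = e' from Subtype.ext he'proj.isSelfAdjoint.star_eq, mul_assoc, mul_sub,
        mul_one, hye', sub_self, mul_zero]
    have h2 : (1 - e') * h = 0 :=
      Subtype.ext (CStarRing.mul_star_self_eq_zero_iff _ |>.1 (congrArg Subtype.val h1))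
    rwa [sub_mul, one_mul, sub_eq_zero, eq_comm] at h2
  have hθhk : (θ h : K →L[ℂ] K) k ≠ 0 := by
    intro h0
    have h1 : θ h * s = 0 := by
      rw [hsupp (θ h) 0 (by rw [h0]; rfl), zero_mul]
    have h2 : h * e' = 0 := EquivLike.injective θ (by rw [map_mul, hθe', h1, map_zero])
    exact hyne (by rw [← hye', ← hhh, mul_assoc, h2, mul_zero])
  obtain ⟨m, hmint, hm⟩ := exists_intertwiner_of_norm_le θ
    (norm_map_apply_le_of_forall_le θ hstar fun z hz0 hzh => hy z hz0 (by rwa [hhh] at hzh))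
  refine hθhk ?_
  rw [← hm]
  refine (hE _).1 ?_ m hmint
  have h1 : e * h = h := by rw [← hhe', ← mul_assoc, hee']
  rw [← h1]
  exact heE _

end Commutant

/-! ### Transport of commutants along a set of operators -/

section Separating

variable {F H K : Type*} [NormedAddCommGroup F] [InnerProductSpace ℂ F]
  [NormedAddCommGroup H] [InnerProductSpace ℂ H] [NormedAddCommGroup K] [InnerProductSpace ℂ K]

/-- The operators in `M` have no common kernel. -/
def IsSeparating (M : Set (H →L[ℂ] K)) : Prop :=
  ∀ ξ, (∀ m ∈ M, m ξ = 0) → ξ = 0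

theorem IsSeparating.cancel_left {M : Set (H →L[ℂ] K)} (hM : IsSeparating M) {S T : F →L[ℂ] H}
    (h : ∀ m ∈ M, m ∘L S = m ∘L T) : S = T := by
  ext v
  rw [← sub_eq_zero]
  refine hM _ fun m hm => ?_
  rw [map_sub, sub_eq_zero]
  exact congrArg (fun a : F →L[ℂ] K => a v) (h m hm)

theorem algebraMap_real_eq_smul (r : ℝ) :
    algebraMap ℝ (H →L[ℂ] H) r = (r : ℂ) • 1 := by
  ext ξ
  exact (Complex.coe_smul r ξ).symm

end Separating

section Transport

variable {F H K : Type*} [NormedAddCommGroup F] [InnerProductSpace ℂ F] [CompleteSpace F]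
  [NormedAddCommGroup H] [InnerProductSpace ℂ H] [CompleteSpace H]
  [NormedAddCommGroup K] [InnerProductSpace ℂ K] [CompleteSpace K]

theorem adjointSet_adjointSet (M : Set (H →L[ℂ] K)) : adjointSet (adjointSet M) = M := by
  ext x
  constructor
  · rintro ⟨_, ⟨m, hm, rfl⟩, rfl⟩
    simpa using hm
  · exact fun hx => ⟨adjoint x, ⟨x, hx, rfl⟩, by simp⟩

theorem IsSeparating.cancel_right {M : Set (H →L[ℂ] K)} (hM : IsSeparating M) {S T : H →L[ℂ] F}
    (h : ∀ m ∈ M, S ∘L adjoint m = T ∘L adjoint m) : S = T := by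
  refine adjoint.injective (hM.cancel_left fun m hm => ?_)
  have := congrArg adjoint (h m hm)
  simpa [adjoint_comp] using this

theorem IsSeparating.cancel {M : Set (H →L[ℂ] K)} (hM : IsSeparating M) {S T : H →L[ℂ] H}
    (h : ∀ m ∈ M, ∀ n ∈ M, m ∘L S ∘L adjoint n = m ∘L T ∘L adjoint n) : S = T :=
  hM.cancel_right fun n hn => hM.cancel_left fun m hm => h m hm n hn

theorem IsSeparating.adjoint_cancel {M : Set (H →L[ℂ] K)} (hM : IsSeparating (adjointSet M))
    {S T : K →L[ℂ] K}
    (h : ∀ m ∈ M, ∀ n ∈ M, adjoint m ∘L S ∘L n = adjoint m ∘L T ∘L n) : S = T := by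
  refine hM.cancel ?_
  rintro _ ⟨m, hm, rfl⟩ _ ⟨n, hn, rfl⟩
  simpa using h m hm n hn

/-- The map `(∑ m ⊗ ξ) ↦ ∑ m x ξ`, on formal sums. -/
noncomputable def sumApply (M : Set (H →L[ℂ] K)) (x : H →L[ℂ] H) : (M × H →₀ ℂ) →ₗ[ℂ] K :=
  Finsupp.linearCombination ℂ fun p => (p.1 : H →L[ℂ] K) (x p.2)

/-- With `y* m* n = m* n y*`, the operators `x` and `y` can be collected on one side. -/
theorem inner_sumApply {M : Set (H →L[ℂ] K)} {y : H →L[ℂ] H}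
    (hy : y ∈ StarSubalgebra.centralizer ℂ (prodSet (adjointSet M) M)) (x : H →L[ℂ] H)
    (v w : M × H →₀ ℂ) :
    inner ℂ (sumApply M y v) (sumApply M x w) =
      inner ℂ (sumApply M 1 v) (sumApply M (star y * x) w) := by
  simp only [sumApply, Finsupp.linearCombination_apply, Finsupp.sum, sum_inner, inner_sum,
    inner_smul_left, inner_smul_right]
  refine Finset.sum_congr rfl fun q _ => ?_
  congr 1
  refine Finset.sum_congr rfl fun p _ => ?_
  congr 1
  have h1 := (StarSubalgebra.mem_centralizer_iff ℂ).1 (star_mem hy) _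
    ⟨_, ⟨p.1, p.1.2, rfl⟩, q.1, q.1.2, rfl⟩
  have h2 := congrArg (fun a : H →L[ℂ] H => a (x q.2)) h1.1
  simp only [mul_apply_eq_comp, comp_apply] at h2
  change _ = inner ℂ ((p.1 : H →L[ℂ] K) p.2) ((q.1 : H →L[ℂ] K) (star y (x q.2)))
  rw [← adjoint_inner_right, ← adjoint_inner_right, ← adjoint_inner_right, h2, star_eq_adjoint]

/-- The difference of the squares of the two sides is `‖∑ m z ξ‖²` with `z² = ‖x‖² - x* x`. -/
theorem norm_sumApply_le {M : Set (H →L[ℂ] K)} {x : H →L[ℂ] H}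
    (hx : x ∈ StarSubalgebra.centralizer ℂ (prodSet (adjointSet M) M)) (v : M × H →₀ ℂ) :
    ‖sumApply M x v‖ ≤ ‖x‖ * ‖sumApply M 1 v‖ := by
  have hc : 0 ≤ algebraMap ℝ (H →L[ℂ] H) (‖x‖ ^ 2) - star x * x :=
    sub_nonneg.2 CStarAlgebra.star_mul_le_algebraMap_norm_sq
  have hcmem : algebraMap ℝ (H →L[ℂ] H) (‖x‖ ^ 2) - star x * x ∈
      StarSubalgebra.centralizer ℂ (prodSet (adjointSet M) M) :=
    sub_mem (by rw [algebraMap_real_eq_smul]; exact SMulMemClass.smul_mem _ (one_mem _))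
      (mul_mem (star_mem hx) hx)
  obtain ⟨⟨z, hz⟩, hz1, hz2⟩ := exists_sqrt_of_nonneg (x := ⟨_, hcmem⟩) hc
  have hz1' : star z = z := congrArg Subtype.val hz1
  have hz2' : z * z = algebraMap ℝ (H →L[ℂ] H) (‖x‖ ^ 2) - star x * x := congrArg Subtype.val hz2
  have h1 := inner_sumApply hz z v v
  have h2 := inner_sumApply hx x v v
  have h3 : sumApply M (star z * z) v =
      ((‖x‖ ^ 2 : ℝ) : ℂ) • sumApply M 1 v - sumApply M (star x * x) v := by
    rw [hz1', hz2', algebraMap_real_eq_smul]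
    simp only [sumApply, Finsupp.linearCombination_apply, Finsupp.sum, Finset.smul_sum,
      ← Finset.sum_sub_distrib]
    refine Finset.sum_congr rfl fun p _ => ?_
    rw [smul_comm, ← smul_sub]
    rw [sub_apply, map_sub, smul_apply, map_smul]
  rw [h3, inner_sub_right, ← h2, inner_smul_right] at h1
  have hre : ∀ (r : ℝ) (w : ℂ), RCLike.re ((r : ℂ) * w) = r * RCLike.re w := by simp
  have h4 : ‖sumApply M z v‖ ^ 2 =
      ‖x‖ ^ 2 * ‖sumApply M 1 v‖ ^ 2 - ‖sumApply M x v‖ ^ 2 := by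
    have h5 := congrArg RCLike.re h1
    rwa [map_sub, hre, inner_self_eq_norm_sq, inner_self_eq_norm_sq, inner_self_eq_norm_sq] at h5
  refine le_of_pow_le_pow_left₀ two_ne_zero (by positivity) ?_
  rw [mul_pow]
  nlinarith [sq_nonneg ‖sumApply M z v‖]

/-- An operator in the commutant of `M* M` is carried by `M` to an operator on the other space. -/
theorem exists_transport {M : Set (H →L[ℂ] K)} (hM : IsSeparating (adjointSet M)) {x : H →L[ℂ] H}
    (hx : x ∈ StarSubalgebra.centralizer ℂ (prodSet (adjointSet M) M)) :
    ∃ T : K →L[ℂ] K, (∀ m ∈ M, T ∘L m = m ∘L x) ∧ ∀ m ∈ M, adjoint m ∘L T = x ∘L adjoint m := by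
  have key : ∀ y ∈ StarSubalgebra.centralizer ℂ (prodSet (adjointSet M) M),
      ∃ T : K →L[ℂ] K, ∀ m ∈ M, T ∘L m = m ∘L y := by
    intro y hy
    obtain ⟨T, hT, -⟩ := exists_clm_of_norm_le (sumApply M 1) (sumApply M y) ‖y‖
      (norm_sumApply_le hy)
    refine ⟨T, fun m hm => ?_⟩
    ext ξ
    simpa [sumApply] using hT (Finsupp.single (⟨m, hm⟩, ξ) 1)
  obtain ⟨T, hT⟩ := key x hx
  -- The adjoint of the operator transported from `x*` is the one transported from `x`.
  obtain ⟨T', hT'⟩ := key (star x) (star_mem hx)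
  have hadj : ∀ m ∈ M, adjoint m ∘L adjoint T' = x ∘L adjoint m := by
    intro m hm
    have := congrArg adjoint (hT' m hm)
    simpa [adjoint_comp, star_eq_adjoint] using this
  have hTT' : adjoint T' = T := by
    refine hM.adjoint_cancel fun m hm n hn => ?_
    rw [← comp_assoc, hadj m hm, hT n hn, comp_assoc]
    exact (((StarSubalgebra.mem_centralizer_iff ℂ).1 hx _ ⟨_, ⟨m, hm, rfl⟩, n, hn, rfl⟩).1).symm
  exact ⟨T, hT, hTT' ▸ hadj⟩

end Transport

section Density

variable {F H L : Type*} [NormedAddCommGroup F] [InnerProductSpace ℂ F] [CompleteSpace F]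
  [NormedAddCommGroup H] [InnerProductSpace ℂ H] [CompleteSpace H]
  [NormedAddCommGroup L] [InnerProductSpace ℂ L] [CompleteSpace L]

theorem adjoint_apply_eq_zero_of_comp {m : F →L[ℂ] L} {k : L} (h : m (adjoint m k) = 0) :
    adjoint m k = 0 := by
  rw [← inner_self_eq_zero (𝕜 := ℂ), adjoint_inner_left, h, inner_zero_right]

/-- For a ternary ring of operators `M`, the span of `M M*` contains a w*-approximate left unit for
the operators whose range lies in the closed span of the ranges of `M`. -/
theorem mem_wStarSpan_of_ternary {M : Submodule ℂ (F →L[ℂ] L)}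
    (hM : ∀ m₁ ∈ M, ∀ m₂ ∈ M, ∀ m₃ ∈ M, m₁ ∘L adjoint m₂ ∘L m₃ ∈ M) {y : H →L[ℂ] L}
    (hy : ∀ k : L, (∀ m ∈ M, adjoint m k = 0) → adjoint y k = 0) :
    y ∈ wStarSpan {z | ∃ m₁ ∈ M, ∃ m₂ ∈ M, z = m₁ ∘L adjoint m₂ ∘L y} := by
  let P : Set (L →L[ℂ] L) := {a | ∃ m₁ ∈ M, ∃ m₂ ∈ M, a = m₁ ∘L adjoint m₂}
  refine wStarSpan_subset_wStarSpan ?_ (mem_wStarSpan_comp (Submodule.span ℂ P) ?_ ?_ y ?_)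
  · rintro _ ⟨a, ha, rfl⟩
    rw [SetLike.mem_coe]
    induction ha using Submodule.span_induction with
    | mem a ha =>
      obtain ⟨m₁, h₁, m₂, h₂, rfl⟩ := ha
      exact Submodule.subset_span ⟨m₁, h₁, m₂, h₂, rfl⟩
    | zero => rw [zero_comp]; exact zero_mem _
    | add a b _ _ ha hb => rw [add_comp]; exact add_mem ha hb
    | smul c a _ ha => rw [smul_comp]; exact Submodule.smul_mem _ c ha
  · intro a ha b hb
    induction ha using Submodule.span_induction with
    | mem a ha =>
      induction hb using Submodule.span_induction with
      | mem b hb =>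
        obtain ⟨m₁, h₁, m₂, h₂, rfl⟩ := ha
        obtain ⟨m₃, h₃, m₄, h₄, rfl⟩ := hb
        exact Submodule.subset_span ⟨_, hM m₁ h₁ m₂ h₂ m₃ h₃, m₄, h₄, rfl⟩
      | zero => rw [comp_zero]; exact zero_mem _
      | add b c _ _ hb hc => rw [comp_add]; exact add_mem hb hc
      | smul c b _ hb => rw [comp_smul]; exact Submodule.smul_mem _ c hb
    | zero => rw [zero_comp]; exact zero_mem _
    | add a c _ _ ha hc => rw [add_comp]; exact add_mem ha hc
    | smul c a _ ha => rw [smul_comp]; exact Submodule.smul_mem _ c ha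
  · intro a ha
    induction ha using Submodule.span_induction with
    | mem a ha =>
      obtain ⟨m₁, h₁, m₂, h₂, rfl⟩ := ha
      exact Submodule.subset_span ⟨m₂, h₂, m₁, h₁, by simp [adjoint_comp]⟩
    | zero => rw [map_zero]; exact zero_mem _
    | add a b _ _ ha hb => rw [map_add]; exact add_mem ha hb
    | smul c a _ ha => rw [map_smulₛₗ]; exact Submodule.smul_mem _ _ ha
  · intro k hk
    exact hy k fun m hm => adjoint_apply_eq_zero_of_comp
      (hk (m ∘L adjoint m) (Submodule.subset_span ⟨m, hm, m, hm, rfl⟩))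

/-- The adjoints of the operators of a subspace, as a subspace. -/
noncomputable def adjointSubmodule (M : Submodule ℂ (F →L[ℂ] L)) : Submodule ℂ (L →L[ℂ] F) where
  carrier := adjointSet (M : Set (F →L[ℂ] L))
  add_mem' := by
    rintro _ _ ⟨a, ha, rfl⟩ ⟨b, hb, rfl⟩
    exact ⟨a + b, M.add_mem ha hb, by rw [map_add]⟩
  zero_mem' := ⟨0, M.zero_mem, by rw [map_zero]⟩
  smul_mem' := by
    rintro c _ ⟨a, ha, rfl⟩
    exact ⟨star c • a, M.smul_mem _ ha, by rw [map_smulₛₗ]; simp⟩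

/-- Nondegeneracy of `M* M`, expressed by the identity or by common kernels. -/
theorem one_mem_wStarSpan_iff {M : Submodule ℂ (F →L[ℂ] L)}
    (hM : ∀ m₁ ∈ M, ∀ m₂ ∈ M, ∀ m₃ ∈ M, m₁ ∘L adjoint m₂ ∘L m₃ ∈ M) :
    1 ∈ wStarSpan (prodSet (adjointSet (M : Set (F →L[ℂ] L))) (M : Set (F →L[ℂ] L))) ↔
      IsSeparating (M : Set (F →L[ℂ] L)) := by
  constructor
  · intro h ξ hξ
    have hcl := isWStarClosed_setOf_inner (H := F) (K := F) (ι := Unit) (fun _ => ξ) (fun _ => 0)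
      (fun _ => ξ) (fun _ => 0)
    let Z : Submodule ℂ (F →L[ℂ] F) :=
      { carrier := {x | ∀ _ : Unit, inner ℂ ξ (x ξ) = inner ℂ (0 : F) (x 0)}
        add_mem' := by
          intro a b ha hb i
          have h1 := ha i
          have h2 := hb i
          simp_all
        zero_mem' := by intro; simp
        smul_mem' := by
          intro c a ha i
          have h1 := ha i
          simp_all }
    have h1 := wStarSpan_subset (Y := Z) hcl (by
      rintro _ ⟨_, ⟨m, hm, rfl⟩, n, hn, rfl⟩ _
      rw [comp_apply, hξ n hn, map_zero, inner_zero_right, inner_zero_left]) h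
    have h2 := h1 ()
    simpa using h2
  · intro h
    have h1 := mem_wStarSpan_of_ternary (M := adjointSubmodule M) (y := (1 : F →L[ℂ] F)) (by
      rintro _ ⟨m₁, h₁, rfl⟩ _ ⟨m₂, h₂, rfl⟩ _ ⟨m₃, h₃, rfl⟩
      exact ⟨_, hM m₃ h₃ m₂ h₂ m₁ h₁, by simp [adjoint_comp, comp_assoc]⟩) (by
      intro k hk
      have : k = 0 := h k fun m hm => by simpa using hk _ ⟨m, hm, rfl⟩
      rw [this, map_zero])
    refine wStarSpan_mono ?_ h1
    rintro _ ⟨_, ⟨m, hm, rfl⟩, _, ⟨n, hn, rfl⟩, rfl⟩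
    exact ⟨_, ⟨m, hm, rfl⟩, n, hn, by rw [adjoint_adjoint]; rfl⟩

end Density

/-! ### Transport of lattices -/

section Lattice

variable {H K : Type*} [NormedAddCommGroup H] [InnerProductSpace ℂ H] [CompleteSpace H]
  [NormedAddCommGroup K] [InnerProductSpace ℂ K] [CompleteSpace K]

theorem star_mem_diagonal {A : Subalgebra ℂ (H →L[ℂ] H)} : ∀ d ∈ diagonal A, star d ∈ diagonal A :=
  fun d hd => ⟨hd.2, by simpa using hd.1⟩

/-- The algebra `Alg ℒ` of a set `ℒ` of idempotents. -/
def algSubalgebra (E : Set (H →L[ℂ] H)) (hE : ∀ p ∈ E, IsIdempotentElem p) :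
    Subalgebra ℂ (H →L[ℂ] H) where
  carrier := algOf E
  mul_mem' := by
    intro a b ha hb p hp
    have h1 := ha p hp
    have h2 := hb p hp
    have h3 : b * p = p * b * p := by
      rwa [sub_mul, sub_mul, one_mul, sub_eq_zero] at h2
    rw [← mul_assoc, mul_assoc _ b p, h3, ← mul_assoc, ← mul_assoc, h1, zero_mul, zero_mul]
  add_mem' := by
    intro a b ha hb p hp
    rw [mul_add, add_mul, ha p hp, hb p hp, add_zero]
  algebraMap_mem' := by
    intro c p hp
    rw [← Algebra.commutes, mul_assoc, sub_mul, one_mul, (hE p hp).eq, sub_self, mul_zero]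

theorem subset_latOf_algOf {E : Set (H →L[ℂ] H)} (hE : ∀ p ∈ E, IsStarProjection p) :
    E ⊆ latOf (algOf E) :=
  fun p hp => ⟨hE p hp, fun _ ha => ha p hp⟩

theorem isReflexiveAlgebra_algSubalgebra {E : Set (H →L[ℂ] H)}
    (hE : ∀ p ∈ E, IsStarProjection p) :
    IsReflexiveAlgebra (algSubalgebra E fun p hp => (hE p hp).isIdempotentElem) :=
  Set.Subset.antisymm (fun _ ha _ hp => hp.2 _ ha) fun _ ha p hp =>
    ha p (subset_latOf_algOf hE hp)

theorem IsReflexiveAlgebra.mem_iff {A : Subalgebra ℂ (H →L[ℂ] H)} (hA : IsReflexiveAlgebra A)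
    {x : H →L[ℂ] H} : x ∈ A ↔ ∀ p ∈ latOf (A : Set (H →L[ℂ] H)), (1 - p) * x * p = 0 :=
  Set.ext_iff.1 hA x

/-- Operators commuting with `Δ(𝒜)'` lie in the reflexive algebra `𝒜`, as they commute with
`Lat 𝒜`. -/
theorem IsReflexiveAlgebra.mem_of_commute {A : Subalgebra ℂ (H →L[ℂ] H)}
    (hA : IsReflexiveAlgebra A) {x : H →L[ℂ] H}
    (hx : ∀ p : diagCommutant A, (p : H →L[ℂ] H) * x = x * p) : x ∈ A := by
  rw [hA.mem_iff]
  intro p hp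
  have h1 : p * x = x * p := hx ⟨p, latOf_subset_diagCommutant A hp⟩
  rw [mul_assoc, ← h1, ← mul_assoc, sub_mul, one_mul, hp.1.isIdempotentElem.eq, sub_self, zero_mul]

/-- A separating set `M` of operators with separating adjoints and `M* M ⊆ 𝒜` transports
`Δ(𝒜)'` and `Lat 𝒜` from `H` to `K`. -/
theorem exists_starAlgEquiv_of_separating {A : Subalgebra ℂ (H →L[ℂ] H)}
    (hA : IsReflexiveAlgebra A) {M : Set (H →L[ℂ] K)} (hM : IsSeparating M)
    (hM' : IsSeparating (adjointSet M)) (hMA : prodSet (adjointSet M) M ⊆ A) :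
    ∃ (B : Subalgebra ℂ (K →L[ℂ] K)) (θ : diagCommutant A ≃⋆ₐ[ℂ] diagCommutant B),
      IsReflexiveAlgebra B ∧
      θ '' {p : diagCommutant A | (p : H →L[ℂ] H) ∈ latOf (A : Set (H →L[ℂ] H))} =
        {q : diagCommutant B | (q : K →L[ℂ] K) ∈ latOf (B : Set (K →L[ℂ] K))} ∧
      ∀ x, ∀ m ∈ M, (θ x : K →L[ℂ] K) ∘L m = m ∘L (x : H →L[ℂ] H) := by
  have hMdiag : prodSet (adjointSet M) M ⊆ diagonal A := by
    rintro _ ⟨_, ⟨m, hm, rfl⟩, n, hn, rfl⟩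
    refine ⟨hMA ⟨_, ⟨m, hm, rfl⟩, n, hn, rfl⟩, hMA ⟨_, ⟨n, hn, rfl⟩, m, hm, ?_⟩⟩
    rw [star_eq_adjoint, adjoint_comp, adjoint_adjoint]
  have hcent : ∀ x : diagCommutant A,
      (x : H →L[ℂ] H) ∈ StarSubalgebra.centralizer ℂ (prodSet (adjointSet M) M) := by
    intro x
    have := (StarSubalgebra.mem_centralizer_iff ℂ).1 x.2
    exact (StarSubalgebra.mem_centralizer_iff ℂ).2 fun d hd => this d (hMdiag hd)
  choose τ hτ hτ' using fun x : diagCommutant A => exists_transport hM' (hcent x)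
  have hext : ∀ {S T : K →L[ℂ] K}, (∀ m ∈ M, S ∘L m = T ∘L m) → S = T := fun h =>
    hM'.cancel_right (by rintro _ ⟨m, hm, rfl⟩; simpa using h m hm)
  have hτone : τ 1 = 1 := hext fun m hm => (hτ 1 m hm).trans rfl
  have hτmul : ∀ x y, τ (x * y) = τ x * τ y := fun x y => hext fun m hm => by
    rw [hτ _ m hm]
    change _ = τ x ∘L τ y ∘L m
    rw [hτ y m hm, ← comp_assoc, hτ x m hm]
    rfl
  have hτadd : ∀ x y, τ (x + y) = τ x + τ y := fun x y => hext fun m hm => by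
    rw [hτ _ m hm, add_comp, hτ x m hm, hτ y m hm, ← comp_add]
    rfl
  have hτsmul : ∀ (c : ℂ) x, τ (c • x) = c • τ x := fun c x => hext fun m hm => by
    rw [hτ _ m hm, smul_comp, hτ x m hm, ← comp_smul]
    rfl
  have hτstar : ∀ x, τ (star x) = star (τ x) := fun x => hext fun m hm => by
    rw [hτ _ m hm]
    have h1 := congrArg adjoint (hτ' x m hm)
    rw [adjoint_comp, adjoint_comp, adjoint_adjoint] at h1
    exact h1.symm
  have hτsub : ∀ x, τ (1 - x) = 1 - τ x := fun x => by
    rw [eq_sub_iff_add_eq, ← hτadd, sub_add_cancel, hτone]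
  let Q : Set (K →L[ℂ] K) :=
    {q | ∃ p : diagCommutant A, (p : H →L[ℂ] H) ∈ latOf (A : Set (H →L[ℂ] H)) ∧ τ p = q}
  have hQ : ∀ q ∈ Q, IsStarProjection q := by
    rintro _ ⟨p, hp, rfl⟩
    constructor
    · change τ p * τ p = τ p
      rw [← hτmul]
      exact congrArg τ (Subtype.ext hp.1.isIdempotentElem.eq)
    · change star (τ p) = τ p
      rw [← hτstar]
      exact congrArg τ (Subtype.ext hp.1.isSelfAdjoint.star_eq)
  let B := algSubalgebra Q fun q hq => (hQ q hq).isIdempotentElem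
  have hB : ∀ {b : K →L[ℂ] K}, b ∈ B ↔ ∀ q ∈ Q, (1 - q) * b * q = 0 := Iff.rfl
  -- `M* ℬ M ⊆ 𝒜` and `M 𝒜 M* ⊆ ℬ`
  have hBA : ∀ m ∈ M, ∀ n ∈ M, ∀ b ∈ B, adjoint m ∘L b ∘L n ∈ A := by
    intro m hm n hn b hb
    rw [hA.mem_iff]
    intro p hp
    let p' : diagCommutant A := ⟨p, latOf_subset_diagCommutant A hp⟩
    have h1 : (1 - p) ∘L adjoint m = adjoint m ∘L (1 - τ p') := by
      rw [← hτsub, hτ' _ m hm]; rfl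
    have h2 : n ∘L p = τ p' ∘L n := (hτ p' n hn).symm
    have h3 : (1 - τ p') ∘L b ∘L τ p' = 0 := hB.1 hb _ ⟨p', hp, rfl⟩
    calc (1 - p) * (adjoint m ∘L b ∘L n) * p
        = ((1 - p) ∘L adjoint m) ∘L b ∘L (n ∘L p) := rfl
      _ = adjoint m ∘L ((1 - τ p') ∘L b ∘L τ p') ∘L n := by rw [h1, h2]; rfl
      _ = 0 := by rw [h3, zero_comp, comp_zero]
  have hAB : ∀ m ∈ M, ∀ n ∈ M, ∀ a ∈ A, m ∘L a ∘L adjoint n ∈ B := by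
    intro m hm n hn a ha
    rw [hB]
    rintro _ ⟨p, hp, rfl⟩
    have h1 : (1 - τ p) ∘L m = m ∘L (1 - (p : H →L[ℂ] H)) := by
      rw [← hτsub, hτ _ m hm]; rfl
    have h2 := hτ' p n hn
    have h3 : (1 - (p : H →L[ℂ] H)) ∘L a ∘L (p : H →L[ℂ] H) = 0 := hp.2 a ha
    calc (1 - τ p) * (m ∘L a ∘L adjoint n) * τ p
        = ((1 - τ p) ∘L m) ∘L a ∘L (adjoint n ∘L τ p) := rfl
      _ = m ∘L ((1 - (p : H →L[ℂ] H)) ∘L a ∘L (p : H →L[ℂ] H)) ∘L adjoint n := by rw [h1, h2]; rfl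
      _ = 0 := by rw [h3, zero_comp, comp_zero]
  have hBA' : ∀ m ∈ M, ∀ n ∈ M, ∀ b ∈ diagonal B, adjoint m ∘L b ∘L n ∈ diagonal A :=
    fun m hm n hn b hb => ⟨hBA m hm n hn b hb.1, by
      have := hBA n hn m hm _ hb.2
      simpa [star_eq_adjoint, adjoint_comp, comp_assoc] using this⟩
  have hAB' : ∀ m ∈ M, ∀ n ∈ M, ∀ a ∈ diagonal A, m ∘L a ∘L adjoint n ∈ diagonal B :=
    fun m hm n hn a ha => ⟨hAB m hm n hn a ha.1, by
      have := hAB n hn m hm _ ha.2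
      simpa [star_eq_adjoint, adjoint_comp, comp_assoc] using this⟩
  have hτmem : ∀ x, τ x ∈ diagCommutant B := by
    intro x
    rw [mem_diagCommutant_iff]
    intro d hd
    refine hM'.adjoint_cancel fun m hm n hn => ?_
    have h1 := (mem_diagCommutant_iff A _).1 x.2 _ (hBA' m hm n hn d hd)
    calc adjoint m ∘L (d * τ x) ∘L n = adjoint m ∘L d ∘L (τ x ∘L n) := rfl
      _ = (adjoint m ∘L d ∘L n) * x := by rw [hτ x n hn]; rfl
      _ = ((x : H →L[ℂ] H) ∘L adjoint m) ∘L d ∘L n := h1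
      _ = adjoint m ∘L (τ x * d) ∘L n := by rw [← hτ' x m hm]; rfl
  let Θ : diagCommutant A →⋆ₐ[ℂ] diagCommutant B :=
    { toFun := fun x => ⟨τ x, hτmem x⟩
      map_one' := Subtype.ext hτone
      map_mul' := fun x y => Subtype.ext (hτmul x y)
      map_zero' := Subtype.ext (by simpa using hτsmul 0 0)
      map_add' := fun x y => Subtype.ext (hτadd x y)
      commutes' := fun c => Subtype.ext (by
        change τ (algebraMap ℂ (diagCommutant A) c) = algebraMap ℂ (K →L[ℂ] K) c
        rw [Algebra.algebraMap_eq_smul_one, Algebra.algebraMap_eq_smul_one, hτsmul, hτone])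
      map_star' := fun x => Subtype.ext (hτstar x) }
  have hΘ : ∀ x, (Θ x : K →L[ℂ] K) = τ x := fun _ => rfl
  have hinj : Function.Injective Θ := by
    intro x y hxy
    refine Subtype.ext (hM.cancel_left fun m hm => ?_)
    rw [← hτ x m hm, ← hτ y m hm, ← hΘ, ← hΘ, hxy]
  -- Transport along `M*` gives the inverse of `Θ`.
  have hsurj : Function.Surjective Θ := by
    intro z
    have hz : (z : K →L[ℂ] K) ∈
        StarSubalgebra.centralizer ℂ (prodSet (adjointSet (adjointSet M)) (adjointSet M)) := by
      have := (StarSubalgebra.mem_centralizer_iff ℂ).1 z.2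
      refine (StarSubalgebra.mem_centralizer_iff ℂ).2 fun d hd => this d ?_
      obtain ⟨m, hm, _, ⟨n, hn, rfl⟩, rfl⟩ := hd
      rw [adjointSet_adjointSet] at hm
      exact hAB' m hm n hn 1 ⟨A.one_mem, by rw [star_one]; exact A.one_mem⟩
    obtain ⟨s, hs, hs'⟩ := exists_transport (by rwa [adjointSet_adjointSet]) hz
    replace hs : ∀ m ∈ M, s ∘L adjoint m = adjoint m ∘L (z : K →L[ℂ] K) :=
      fun m hm => hs _ ⟨m, hm, rfl⟩
    replace hs' : ∀ m ∈ M, m ∘L s = (z : K →L[ℂ] K) ∘L m := fun m hm => by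
      simpa using hs' _ ⟨m, hm, rfl⟩
    have hsmem : s ∈ diagCommutant A := by
      rw [mem_diagCommutant_iff]
      intro d hd
      refine hM.cancel fun m hm n hn => ?_
      have h1 := (mem_diagCommutant_iff B _).1 z.2 _ (hAB' m hm n hn d hd)
      calc m ∘L (d * s) ∘L adjoint n = m ∘L d ∘L (s ∘L adjoint n) := rfl
        _ = (m ∘L d ∘L adjoint n) * z := by rw [hs n hn]; rfl
        _ = ((z : K →L[ℂ] K) ∘L m) ∘L d ∘L adjoint n := h1
        _ = m ∘L (s * d) ∘L adjoint n := by rw [← hs' m hm]; rfl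
    refine ⟨⟨s, hsmem⟩, Subtype.ext (hext fun m hm => ?_)⟩
    rw [hΘ, hτ _ m hm, ← hs' m hm]
  have hBrefl : IsReflexiveAlgebra B := isReflexiveAlgebra_algSubalgebra hQ
  refine ⟨B, StarAlgEquiv.ofBijective Θ ⟨hinj, hsurj⟩, hBrefl, ?_, fun x m hm => hτ x m hm⟩
  apply Set.Subset.antisymm
  · rintro _ ⟨p, hp, rfl⟩
    exact subset_latOf_algOf hQ ⟨p, hp, rfl⟩
  · intro q hq
    obtain ⟨p, rfl⟩ := hsurj q
    refine ⟨p, ⟨?_, fun a ha => ?_⟩, rfl⟩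
    · constructor
      · have h1 : p * p = p := hinj (by
          rw [map_mul]; exact Subtype.ext hq.1.isIdempotentElem.eq)
        exact congrArg Subtype.val h1
      · have h1 : star p = p := hinj (by
          rw [map_star]; exact Subtype.ext hq.1.isSelfAdjoint.star_eq)
        exact congrArg Subtype.val h1
    · refine hM.cancel fun m hm n hn => ?_
      have h1 : (1 - τ p) ∘L m = m ∘L (1 - (p : H →L[ℂ] H)) := by
        rw [← hτsub, hτ _ m hm]; rfl
      have h2 := hτ' p n hn
      have h3 : (1 - τ p) * (m ∘L a ∘L adjoint n) * τ p = 0 := hq.2 _ (hAB m hm n hn a ha)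
      calc m ∘L ((1 - (p : H →L[ℂ] H)) * a * (p : H →L[ℂ] H)) ∘L adjoint n
          = (m ∘L (1 - (p : H →L[ℂ] H))) ∘L a ∘L ((p : H →L[ℂ] H) ∘L adjoint n) := rfl
        _ = (1 - τ p) * (m ∘L a ∘L adjoint n) * τ p := by rw [← h1, ← h2]; rfl
        _ = m ∘L 0 ∘L adjoint n := by rw [h3, zero_comp, comp_zero]

end Lattice

/-! ### Intertwiners and the module they generate -/

section Intertwiners

variable {H K : Type*} [NormedAddCommGroup H] [InnerProductSpace ℂ H] [CompleteSpace H]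
  [NormedAddCommGroup K] [InnerProductSpace ℂ K] [CompleteSpace K]
  {A : Subalgebra ℂ (H →L[ℂ] H)} {B : Subalgebra ℂ (K →L[ℂ] K)}

/-- The intertwiners of `θ`. -/
def intertwiners (θ : diagCommutant A →⋆ₐ[ℂ] diagCommutant B) : Submodule ℂ (H →L[ℂ] K) where
  carrier := {m | ∀ x, (θ x : K →L[ℂ] K) ∘L m = m ∘L (x : H →L[ℂ] H)}
  add_mem' := by
    intro m n hm hn x
    rw [comp_add, add_comp, hm x, hn x]
  zero_mem' := by
    intro x
    rw [comp_zero, zero_comp]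
  smul_mem' := by
    intro c m hm x
    rw [comp_smul, smul_comp, hm x]

theorem adjoint_comp_eq_of_comp_eq {θ : diagCommutant A →⋆ₐ[ℂ] diagCommutant B} {m : H →L[ℂ] K}
    (hm : ∀ x, (θ x : K →L[ℂ] K) ∘L m = m ∘L (x : H →L[ℂ] H)) (x : diagCommutant A) :
    adjoint m ∘L (θ x : K →L[ℂ] K) = (x : H →L[ℂ] H) ∘L adjoint m := by
  have h1 := congrArg adjoint (hm (star x))
  rw [map_star, adjoint_comp, adjoint_comp] at h1
  change _ ∘L adjoint (star (θ x : K →L[ℂ] K)) = adjoint (star (x : H →L[ℂ] H)) ∘L _ at h1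
  rwa [← star_eq_adjoint (star (θ x : K →L[ℂ] K)), ← star_eq_adjoint (star (x : H →L[ℂ] H)),
    star_star, star_star] at h1

theorem ternary_mem_intertwiners (θ : diagCommutant A →⋆ₐ[ℂ] diagCommutant B) :
    ∀ m₁ ∈ intertwiners θ, ∀ m₂ ∈ intertwiners θ, ∀ m₃ ∈ intertwiners θ,
      m₁ ∘L adjoint m₂ ∘L m₃ ∈ intertwiners θ := by
  intro m₁ h₁ m₂ h₂ m₃ h₃ x
  rw [← comp_assoc, h₁ x, comp_assoc, ← comp_assoc _ (adjoint m₂),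
    ← adjoint_comp_eq_of_comp_eq h₂, comp_assoc, h₃ x, comp_assoc, comp_assoc]

theorem isSeparating_intertwiners (θ : diagCommutant A ≃⋆ₐ[ℂ] diagCommutant B) :
    IsSeparating (intertwiners (θ : diagCommutant A →⋆ₐ[ℂ] diagCommutant B) :
      Set (H →L[ℂ] K)) :=
  fun _ hξ => eq_zero_of_forall_intertwiner star_mem_diagonal star_mem_diagonal θ
    fun m hm => hξ m hm

theorem isSeparating_adjointSet_intertwiners (θ : diagCommutant A ≃⋆ₐ[ℂ] diagCommutant B) :
    IsSeparating (adjointSet (intertwiners (θ : diagCommutant A →⋆ₐ[ℂ] diagCommutant B) :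
      Set (H →L[ℂ] K))) := by
  intro k hk
  refine eq_zero_of_forall_intertwiner star_mem_diagonal star_mem_diagonal θ.symm fun n hn => ?_
  refine hk n ⟨adjoint n, fun x => ?_, (adjoint_adjoint n).symm⟩
  have h1 := congrArg adjoint (hn (θ (star x)))
  have h2 : θ.symm (θ (star x)) = star x := θ.symm_apply_apply _
  erw [h2] at h1
  rw [map_star, adjoint_comp, adjoint_comp] at h1
  change _ ∘L adjoint (star (x : H →L[ℂ] H)) = adjoint (star (θ x : K →L[ℂ] K)) ∘L _ at h1
  rw [← star_eq_adjoint (star (θ x : K →L[ℂ] K)), ← star_eq_adjoint (star (x : H →L[ℂ] H)),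
    star_star, star_star] at h1
  exact h1.symm

theorem adjoint_comp_mem_of_intertwiners (hA : IsReflexiveAlgebra A)
    {θ : diagCommutant A →⋆ₐ[ℂ] diagCommutant B} {m n : H →L[ℂ] K}
    (hm : m ∈ intertwiners θ) (hn : n ∈ intertwiners θ) : adjoint m ∘L n ∈ A := by
  refine hA.mem_of_commute fun p => ?_
  change ((p : H →L[ℂ] H) ∘L adjoint m) ∘L n = adjoint m ∘L (n ∘L (p : H →L[ℂ] H))
  rw [← adjoint_comp_eq_of_comp_eq hm, ← hn p, comp_assoc]

end Intertwiners

section Inclusion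

variable {H L : Type*} [NormedAddCommGroup H] [InnerProductSpace ℂ H]
  [NormedAddCommGroup L] [InnerProductSpace ℂ L]

/-- Operators into a subspace `K` of `L`, regarded as operators into `L`. -/
def inclusionComp (H : Type*) [NormedAddCommGroup H] [InnerProductSpace ℂ H] (K : Submodule ℂ L) :
    (H →L[ℂ] K) →ₗ[ℂ] (H →L[ℂ] L) where
  toFun y := K.subtypeL ∘L y
  map_add' _ _ := comp_add _ _ _
  map_smul' _ _ := comp_smul _ _ _

theorem mem_range_inclusionComp_iff {K : Submodule ℂ L} [K.HasOrthogonalProjection]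
    {T : H →L[ℂ] L} :
    T ∈ LinearMap.range (inclusionComp H K) ↔ ∀ i : Kᗮ × H, inner ℂ (i.1 : L) (T i.2) = 0 := by
  constructor
  · rintro ⟨y, rfl⟩ i
    exact Submodule.inner_left_of_mem_orthogonal (y i.2).2 i.1.2
  · intro h
    have hT : ∀ ξ, T ξ ∈ K := fun ξ => by
      rw [← K.orthogonal_orthogonal, Submodule.mem_orthogonal]
      exact fun u hu => h (⟨u, hu⟩, ξ)
    exact ⟨T.codRestrict K hT, rfl⟩

end Inclusion

section Modules

variable {H L : Type*} [NormedAddCommGroup H] [InnerProductSpace ℂ H] [CompleteSpace H]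
  [NormedAddCommGroup L] [InnerProductSpace ℂ L]
  {K : Submodule ℂ L} [CompleteSpace K]
  {A : Subalgebra ℂ (H →L[ℂ] H)} {B : Subalgebra ℂ (K →L[ℂ] K)}

/-- `opSpace θ` as a linear subspace. -/
def opSubmodule (θ : diagCommutant A → diagCommutant B) : Submodule ℂ (H →L[ℂ] K) where
  carrier := opSpace θ
  add_mem' := by
    intro y z hy hz p hp
    rw [add_comp, comp_add, hy p hp, hz p hp, add_zero]
  zero_mem' := by
    intro p _
    rw [zero_comp, comp_zero]
  smul_mem' := by
    intro c y hy p hp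
    rw [smul_comp, comp_smul, hy p hp, smul_zero]

theorem isWStarClosed_opSubmodule (θ : diagCommutant A → diagCommutant B) :
    IsWStarClosed ((opSubmodule θ).map (inclusionComp H K) : Set (H →L[ℂ] L)) := by
  let J := {p : diagCommutant A // (p : H →L[ℂ] H) ∈ latOf (A : Set (H →L[ℂ] H))} × K × H
  have h1 := isWStarClosed_setOf_inner (H := H) (K := L) (fun i : Kᗮ × H => (i.1 : L))
    (fun _ => 0) (fun i => i.2) (fun _ => 0)
  have h2 := isWStarClosed_setOf_inner (H := H) (K := L)
    (fun i : J => ((adjoint (1 - (θ i.1 : K →L[ℂ] K)) i.2.1 : K) : L))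
    (fun _ => 0) (fun i => (i.1 : H →L[ℂ] H) i.2.2) (fun _ => 0)
  have h3 := h1.inter h2
  refine (congrArg IsWStarClosed ?_).mp h3
  have key : ∀ (y : H →L[ℂ] K) (i : J),
      inner ℂ ((adjoint (1 - (θ i.1 : K →L[ℂ] K)) i.2.1 : K) : L)
        (inclusionComp H K y ((i.1 : H →L[ℂ] H) i.2.2)) =
      inner ℂ i.2.1 (((1 - (θ i.1 : K →L[ℂ] K)) ∘L y ∘L (i.1 : H →L[ℂ] H)) i.2.2) := by
    intro y i
    exact adjoint_inner_left (1 - (θ i.1 : K →L[ℂ] K)) (y ((i.1 : H →L[ℂ] H) i.2.2)) i.2.1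
  ext T
  simp only [inner_zero_left]
  constructor
  · rintro ⟨hT1, hT2⟩
    obtain ⟨y, rfl⟩ := mem_range_inclusionComp_iff.2 hT1
    refine ⟨y, fun p hp => ?_, rfl⟩
    ext ξ
    refine congrArg Subtype.val (ext_inner_left ℂ fun k => ?_)
    rw [← key y (⟨p, hp⟩, k, ξ), hT2 (⟨p, hp⟩, k, ξ), zero_apply, inner_zero_right]
  · rintro ⟨y, hy, rfl⟩
    refine ⟨mem_range_inclusionComp_iff.1 ⟨y, rfl⟩, fun i => ?_⟩
    rw [key, hy i.1.1 i.1.2, zero_apply, inner_zero_right]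

theorem isWStarClosed_intertwiners (θ : diagCommutant A →⋆ₐ[ℂ] diagCommutant B) :
    IsWStarClosed ((intertwiners θ).map (inclusionComp H K) : Set (H →L[ℂ] L)) := by
  have h1 := isWStarClosed_setOf_inner (H := H) (K := L) (fun i : Kᗮ × H => (i.1 : L))
    (fun _ => 0) (fun i => i.2) (fun _ => 0)
  have h2 := isWStarClosed_setOf_inner (H := H) (K := L)
    (fun i : diagCommutant A × K × H => ((adjoint (θ i.1 : K →L[ℂ] K) i.2.1 : K) : L))
    (fun i => i.2.1) (fun i => i.2.2) (fun i => (i.1 : H →L[ℂ] H) i.2.2)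
  have h3 := h1.inter h2
  refine (congrArg IsWStarClosed ?_).mp h3
  have key : ∀ (y : H →L[ℂ] K) (i : diagCommutant A × K × H),
      inner ℂ ((adjoint (θ i.1 : K →L[ℂ] K) i.2.1 : K) : L) (inclusionComp H K y i.2.2) =
      inner ℂ i.2.1 (((θ i.1 : K →L[ℂ] K) ∘L y) i.2.2) := by
    intro y i
    exact adjoint_inner_left (θ i.1 : K →L[ℂ] K) (y i.2.2) i.2.1
  ext T
  simp only [inner_zero_left]
  constructor
  · rintro ⟨hT1, hT2⟩
    obtain ⟨y, rfl⟩ := mem_range_inclusionComp_iff.2 hT1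
    refine ⟨y, fun x => ?_, rfl⟩
    ext ξ
    refine congrArg Subtype.val (ext_inner_left ℂ fun k => ?_)
    rw [← key y (x, k, ξ), hT2 (x, k, ξ)]
    rfl
  · rintro ⟨y, hy, rfl⟩
    refine ⟨mem_range_inclusionComp_iff.1 ⟨y, rfl⟩, fun i => ?_⟩
    rw [key, hy i.1]
    rfl
variable [CompleteSpace L]

theorem adjoint_subtypeL_comp_subtypeL : adjoint K.subtypeL ∘L K.subtypeL = 1 := by
  ext v
  refine congrArg Subtype.val (ext_inner_left ℂ fun w => ?_)
  rw [comp_apply, adjoint_inner_right]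
  rfl

theorem adjoint_subtypeL_comp_comp {F : Type*} [NormedAddCommGroup F] [InnerProductSpace ℂ F]
    (m n : F →L[ℂ] K) [CompleteSpace F] :
    adjoint (K.subtypeL ∘L m) ∘L K.subtypeL ∘L n = adjoint m ∘L n := by
  rw [adjoint_comp, comp_assoc, ← comp_assoc (adjoint K.subtypeL), adjoint_subtypeL_comp_subtypeL]
  rfl

theorem adjoint_inclusionComp (m : H →L[ℂ] K) :
    adjoint (inclusionComp H K m) = adjoint m ∘L adjoint K.subtypeL :=
  adjoint_comp _ _

/-- If the ternary ring `M` intertwines `θ`, then the w*-closed span of `M 𝒜` consists of all `y`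
with `θ(p)^⊥ y p = 0` for `p ∈ Lat 𝒜`: such `y` satisfy `M* y ⊆ 𝒜`, and `y` is in the w*-closed
span of `M M* y`. -/
theorem wStarSpan_prodSet_eq_opSpace (hA : IsReflexiveAlgebra A)
    (θ : diagCommutant A →⋆ₐ[ℂ] diagCommutant B) {M : Submodule ℂ (H →L[ℂ] K)}
    (hM : ∀ m₁ ∈ M, ∀ m₂ ∈ M, ∀ m₃ ∈ M, m₁ ∘L adjoint m₂ ∘L m₃ ∈ M)
    (hM' : IsSeparating (adjointSet (M : Set (H →L[ℂ] K))))
    (hθ : ∀ x, ∀ m ∈ M, (θ x : K →L[ℂ] K) ∘L m = m ∘L (x : H →L[ℂ] H)) :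
    wStarSpan (prodSet (M.map (inclusionComp H K) : Set (H →L[ℂ] L)) (A : Set (H →L[ℂ] H))) =
      (fun y : H →L[ℂ] K => K.subtypeL ∘L y) '' opSpace θ := by
  have hθ' := fun x m hm => adjoint_comp_eq_of_comp_eq (θ := θ) (hθ · m hm) x
  apply Set.Subset.antisymm
  · refine wStarSpan_subset (Y := (opSubmodule θ).map (inclusionComp H K))
      (isWStarClosed_opSubmodule θ) ?_
    rintro _ ⟨_, ⟨m, hm, rfl⟩, a, ha, rfl⟩
    refine ⟨m ∘L a, fun p hp => ?_, rfl⟩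
    have h1 : (1 - (θ p : K →L[ℂ] K)) ∘L m = m ∘L (1 - (p : H →L[ℂ] H)) := by
      rw [sub_comp, comp_sub, hθ p m hm]; rfl
    have h2 : (1 - (p : H →L[ℂ] H)) ∘L a ∘L (p : H →L[ℂ] H) = 0 := hp.2 a ha
    rw [comp_assoc, ← comp_assoc, h1, comp_assoc, h2, comp_zero]
  · rintro _ ⟨y, hy, rfl⟩
    have hyA : ∀ m ∈ M, adjoint m ∘L y ∈ A := by
      intro m hm
      rw [hA.mem_iff]
      intro p hp
      let p' : diagCommutant A := ⟨p, latOf_subset_diagCommutant A hp⟩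
      have h1 : (1 - p) ∘L adjoint m = adjoint m ∘L (1 - (θ p' : K →L[ℂ] K)) := by
        rw [sub_comp, comp_sub, hθ' p' m hm]; rfl
      have h2 : (1 - (θ p' : K →L[ℂ] K)) ∘L y ∘L p = 0 := hy p' hp
      calc (1 - p) * (adjoint m ∘L y) * p = ((1 - p) ∘L adjoint m) ∘L y ∘L p := rfl
        _ = adjoint m ∘L ((1 - (θ p' : K →L[ℂ] K)) ∘L y ∘L p) := by rw [h1, comp_assoc]
        _ = 0 := by rw [h2, comp_zero]
    have h1 := mem_wStarSpan_of_ternary (M := M.map (inclusionComp H K))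
      (y := K.subtypeL ∘L y) (by
        rintro _ ⟨m₁, h₁, rfl⟩ _ ⟨m₂, h₂, rfl⟩ _ ⟨m₃, h₃, rfl⟩
        exact ⟨_, hM m₁ h₁ m₂ h₂ m₃ h₃, by
          simp only [inclusionComp, LinearMap.coe_mk, AddHom.coe_mk, comp_assoc,
            adjoint_subtypeL_comp_comp]⟩) (by
        intro k hk
        have h2 : adjoint K.subtypeL k = 0 := hM' _ (by
          rintro _ ⟨m, hm, rfl⟩
          have := hk _ ⟨m, hm, rfl⟩
          rw [adjoint_inclusionComp, comp_apply] at this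
          exact this)
        rw [adjoint_comp, comp_apply, h2, map_zero])
    refine wStarSpan_mono ?_ h1
    rintro _ ⟨_, ⟨m, hm, rfl⟩, _, ⟨n, hn, rfl⟩, rfl⟩
    refine ⟨_, ⟨m, hm, rfl⟩, _, hyA n hn, ?_⟩
    simp only [inclusionComp, LinearMap.coe_mk, AddHom.coe_mk, adjoint_subtypeL_comp_comp]

/-- The ternary ring is the space of intertwiners of `θ`. -/
theorem isConcreteStronglyProjectivelyRigged_of_opSpace (hA : IsReflexiveAlgebra A)
    {Y : Submodule ℂ (H →L[ℂ] L)} (θ : diagCommutant A ≃⋆ₐ[ℂ] diagCommutant B)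
    (hYθ : (Y : Set (H →L[ℂ] L)) = (fun y : H →L[ℂ] K => K.subtypeL ∘L y) '' opSpace θ) :
    IsConcreteStronglyProjectivelyRigged A Y := by
  let θ' : diagCommutant A →⋆ₐ[ℂ] diagCommutant B := θ
  have htern : ∀ m₁ ∈ (intertwiners θ').map (inclusionComp H K),
      ∀ m₂ ∈ (intertwiners θ').map (inclusionComp H K),
      ∀ m₃ ∈ (intertwiners θ').map (inclusionComp H K),
      m₁ ∘L adjoint m₂ ∘L m₃ ∈
        (intertwiners θ').map (inclusionComp H K) := by
    rintro _ ⟨m₁, h₁, rfl⟩ _ ⟨m₂, h₂, rfl⟩ _ ⟨m₃, h₃, rfl⟩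
    exact ⟨_, ternary_mem_intertwiners θ' m₁ h₁ m₂ h₂ m₃ h₃, by
      simp only [inclusionComp, LinearMap.coe_mk, AddHom.coe_mk,
        comp_assoc, adjoint_subtypeL_comp_comp]⟩
  refine ⟨(intertwiners θ').map (inclusionComp H K),
    ⟨isWStarClosed_intertwiners θ', htern⟩, ?_, (one_mem_wStarSpan_iff htern).2 ?_, ?_⟩
  · rintro _ ⟨_, ⟨_, ⟨m, hm, rfl⟩, rfl⟩, _, ⟨n, hn, rfl⟩, rfl⟩
    have := adjoint_comp_mem_of_intertwiners hA hm hn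
    rw [← adjoint_subtypeL_comp_comp] at this
    exact this
  · intro ξ hξ
    refine isSeparating_intertwiners θ ξ fun m hm => ?_
    exact Subtype.ext (hξ _ ⟨m, hm, rfl⟩)
  · rw [hYθ]
    exact (wStarSpan_prodSet_eq_opSpace hA θ' (ternary_mem_intertwiners θ')
      (isSeparating_adjointSet_intertwiners θ) fun x m hm => hm x).symm

/-- The space `K` is the closed span of the ranges of the ternary ring, and `ℬ` is the algebra of
the transported lattice. -/
theorem IsConcreteStronglyProjectivelyRigged.exists_opSpace {A : Subalgebra ℂ (H →L[ℂ] H)}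
    (hA : IsReflexiveAlgebra A) {Y : Submodule ℂ (H →L[ℂ] L)}
    (h : IsConcreteStronglyProjectivelyRigged A Y) :
    ∃ (K : Submodule ℂ L) (_ : CompleteSpace K) (B : Subalgebra ℂ (K →L[ℂ] K))
      (θ : diagCommutant A ≃⋆ₐ[ℂ] diagCommutant B), IsReflexiveAlgebra B ∧
      θ '' {p : diagCommutant A | (p : H →L[ℂ] H) ∈ latOf (A : Set (H →L[ℂ] H))} =
        {q : diagCommutant B | (q : K →L[ℂ] K) ∈ latOf (B : Set (K →L[ℂ] K))} ∧
      (Y : Set (H →L[ℂ] L)) = (fun y : H →L[ℂ] K => K.subtypeL ∘L y) '' opSpace θ := by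
  obtain ⟨M, hM, hMA, h1, hYM⟩ := h
  have hsep := (one_mem_wStarSpan_iff hM.ternary_mem).1 h1
  -- `K` is the closed span of the ranges of the operators in `M`.
  let W : Submodule ℂ L := Submodule.span ℂ {v | ∃ m ∈ M, ∃ ξ, m ξ = v}
  let K := W.topologicalClosure
  have hK : CompleteSpace K := (Submodule.isClosed_topologicalClosure _).completeSpace_coe
  have hMK : ∀ m ∈ M, ∀ ξ, m ξ ∈ K := fun m hm ξ =>
    W.le_topologicalClosure (Submodule.subset_span ⟨m, hm, ξ, rfl⟩)
  let N : Submodule ℂ (H →L[ℂ] K) := M.comap (inclusionComp H K)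
  have hNM : N.map (inclusionComp H K) = M := by
    rw [Submodule.map_comap_eq, inf_eq_right]
    exact fun m hm => ⟨m.codRestrict K (hMK m hm), rfl⟩
  have hlift : ∀ m ∈ M, ∃ n ∈ N, K.subtypeL ∘L n = m := by
    intro m hm
    rw [← hNM] at hm
    exact hm
  have hN : ∀ m₁ ∈ N, ∀ m₂ ∈ N, ∀ m₃ ∈ N, m₁ ∘L adjoint m₂ ∘L m₃ ∈ N := by
    intro m₁ h₁ m₂ h₂ m₃ h₃
    have := hM.ternary_mem _ h₁ _ h₂ _ h₃
    simp only [inclusionComp, LinearMap.coe_mk, AddHom.coe_mk,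
      comp_assoc, adjoint_subtypeL_comp_comp] at this
    exact this
  have hNsep : IsSeparating (N : Set (H →L[ℂ] K)) := by
    intro ξ hξ
    refine hsep ξ fun m hm => ?_
    obtain ⟨n, hn, rfl⟩ := hlift m hm
    rw [comp_apply, hξ n hn, map_zero]
  have hNsep' : IsSeparating
      (adjointSet (N : Set (H →L[ℂ] K))) := by
    intro k hk
    have hW : (k : L) ∈ Wᗮ := by
      rw [Submodule.mem_orthogonal]
      intro u hu
      induction hu using Submodule.span_induction with
      | mem u hu =>
        obtain ⟨m, hm, ξ, rfl⟩ := hu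
        obtain ⟨n, hn, rfl⟩ := hlift m hm
        have h2 := hk _ ⟨n, hn, rfl⟩
        change inner ℂ (n ξ) k = 0
        rw [← adjoint_inner_right, h2, inner_zero_right]
      | zero => rw [inner_zero_left]
      | add u v _ _ hu hv => rw [inner_add_left, hu, hv, add_zero]
      | smul c u _ hu => rw [inner_smul_left, hu, mul_zero]
    rw [← Submodule.orthogonal_closure] at hW
    exact Subtype.ext (inner_self_eq_zero.1 (Submodule.inner_right_of_mem_orthogonal k.2 hW))
  have hNA : prodSet (adjointSet (N : Set (H →L[ℂ] K)))
      (N : Set (H →L[ℂ] K)) ⊆ A := by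
    rintro _ ⟨_, ⟨m, hm, rfl⟩, n, hn, rfl⟩
    rw [← adjoint_subtypeL_comp_comp]
    exact hMA ⟨_, ⟨_, hm, rfl⟩, _, hn, rfl⟩
  obtain ⟨B, θ, hB, hlat, hθ⟩ :=
    exists_starAlgEquiv_of_separating hA hNsep hNsep' hNA
  refine ⟨K, hK, B, θ, hB, hlat, ?_⟩
  rw [hYM, ← hNM]
  exact wStarSpan_prodSet_eq_opSpace hA
    (θ : diagCommutant A →⋆ₐ[ℂ] diagCommutant B) hN hNsep' hθ

end Modules

end RiggedModules

theorem theorem2 {H L : Type*}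
    [NormedAddCommGroup H] [InnerProductSpace ℂ H] [CompleteSpace H]
    [NormedAddCommGroup L] [InnerProductSpace ℂ L] [CompleteSpace L]
    (A : Subalgebra ℂ (H →L[ℂ] H)) (hA : RiggedModules.IsReflexiveAlgebra A)
    (Y : Submodule ℂ (H →L[ℂ] L)) (hY : RiggedModules.IsWStarClosed (Y : Set (H →L[ℂ] L))) :
    RiggedModules.IsConcreteStronglyProjectivelyRigged A Y ↔
      ∃ (K : Submodule ℂ L) (_ : CompleteSpace K) (B : Subalgebra ℂ (K →L[ℂ] K))
        (θ : RiggedModules.diagCommutant A ≃⋆ₐ[ℂ] RiggedModules.diagCommutant B),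
        RiggedModules.IsReflexiveAlgebra B ∧
        θ '' {p : RiggedModules.diagCommutant A | (p : H →L[ℂ] H) ∈ RiggedModules.latOf (A : Set (H →L[ℂ] H))} =
          {q : RiggedModules.diagCommutant B | (q : K →L[ℂ] K) ∈ RiggedModules.latOf (B : Set (K →L[ℂ] K))} ∧
        (Y : Set (H →L[ℂ] L)) =
          (fun y : H →L[ℂ] K => K.subtypeL ∘L y) '' RiggedModules.opSpace θ := by
  constructor
  · exact RiggedModules.IsConcreteStronglyProjectivelyRigged.exists_opSpace hA
  · rintro ⟨K, hK, B, θ, -, -, hYθ⟩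
    exact RiggedModules.isConcreteStronglyProjectivelyRigged_of_opSpace hA θ hYθ
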